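/- Let $n\ge 0$, let $\mathfrak{igl}(n)$ be the complex Lie algebra with basis $L^\mu_\nu, P_\mu$ ($0\le\mu,\nu\le n-1$) and brackets $[L^\mu_\nu,L^\rho_\lambda]=-i\delta^\rho_\nu L^\mu_\lambda+i\delta^\mu_\lambda L^\rho_\nu$, $[L^\mu_\nu,P_\lambda]=i\delta^\mu_\lambda P_\nu$, $[P_\mu,P_\nu]=0$, and let $U=U(\mathfrak{igl}(n))$ be its enveloping algebra with the primitive coproduct $\Delta$ and counit $\epsilon$. Let $\mathfrak X^n=\mathbb C[x^0,\dots,x^{n-1}]$, on which $U$ acts by $P_\mu\triangleright=-i\partial_\mu$, $L^\mu_\nu\triangleright=-i x^\mu\partial_\nu$; let $\mathfrak T^n=\mathbb C[P_0,\dots,P_{n-1}]\subset U$; and let $\mathfrak W^n$ be the Weyl algebra, generated by $x^\mu,P_\mu$ with $[x^\mu,x^\nu]=[P_\mu,P_\nu]=0$, $[P_\mu,x^\nu]=-i\delta^\nu_\mu$. For a complex vector space $V$, $V[[h]]$ denotes the formal power series with coefficients in $V$. Let $\mathcal F\in (U\otimes U)[[h]]$ be a twist: $\mathcal F$ is invertible,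 $\mathcal F\equiv 1\otimes 1 \bmod h$, $\mathcal F_{12}(\Delta\otimes \mathrm{id})\mathcal F=\mathcal F_{23}(\mathrm{id}\otimes\Delta)\mathcal F$ and $(\epsilon\otimes\mathrm{id})\mathcal F=1=(\mathrm{id}\otimes\epsilon)\mathcal F$. Write $\mathcal F^{-1}=\bar{\mathrm f}^\alpha\otimes\bar{\mathrm f}_\alpha$, $f\star g=(\bar{\mathrm f}^\alpha\triangleright f)(\bar{\mathrm f}_\alpha\triangleright g)$ and $\Delta^{\mathcal F}(u)=\mathcal F\Delta(u)\mathcal F^{-1}=u_{(1)}\otimes u_{(2)}$. The smash product $\mathfrak X^n[[h]]^{\mathcal F}\rtimes U[[h]]^{\mathcal F}$ is the module $(\mathfrak X^n\otimes U)[[h]]$ with the $\mathbb C[[h]]$-bilinear, $h$-adically continuous product $(f\otimes u)\#(g\otimes w)=f\star(u_{(1)}\triangleright g)\otimes u_{(2)}w$. Let $\mathfrak W^n[[h]]^{\mathcal F}=\mathfrak X^n[[h]]^{\mathcal F}\rtimes\mathfrak T^n[[h]]^{\mathcal F}$ be its $\mathbb C[[h]]$-submodule $(\mathfrak X^n\otimes\mathfrak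 T^n)[[h]]$. It is defined as an algebra when the momenta form a Hopf subalgebra of $U[[h]]^{\mathcal F}$, i.e. when $\Delta^{\mathcal F}(\mathfrak T^n)\subset(\mathfrak T^n\otimes\mathfrak T^n)[[h]]$. Then: 1. If $\Delta^{\mathcal F}(\mathfrak T^n)\subset(\mathfrak T^n\otimes\mathfrak T^n)[[h]]$, then $\mathfrak W^n[[h]]^{\mathcal F}$ is closed under the product $\#$. 2. For every twist $\mathcal F$ there is a $\mathbb C[[h]]$-linear bijection $e:\mathfrak W^n[[h]]^{\mathcal F}\to\mathfrak W^n[[h]]$ with $e(1)=1$ and $e(a\# b)=e(a)e(b)$ for all $a,b\in\mathfrak W^n[[h]]^{\mathcal F}$ with $a\# b\in \mathfrak W^n[[h]]^{\mathcal F}$. It is the identity on momenta, $e(p)=p$ for $p\in\mathfrak T^n$, and for $f\in\mathfrak X^n$ it is $e(f)=\hat f$, the element of $\mathfrak W^n[[h]]$ obtained from $(\bar{\mathrm f}^\alpha\triangleright f)\cdot\bar{\mathrm f}_\alpha$ by the Heisenberg realization $P_\mu\mapsto P_\mu$, $L^\nu_\mu\mapsto x^\nu P_\mu$. In particular, in the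 situation of 1, $\mathfrak W^n[[h]]^{\mathcal F}$ is a unital associative algebra isomorphic over $\mathbb C[[h]]$ to $\mathfrak W^n[[h]]$. 3. The elements $\hat x^\mu, P_\mu$ again generate $\mathfrak W^n[[h]]$: the $\mathbb C[[h]]$-subalgebra that they generate is dense in the $h$-adic topology. -/

import Mathlib

open scoped TensorProduct PowerSeries

noncomputable section

namespace TwistedWeyl

/-! ### Formal power series with coefficients in a complex algebra

`A⟦X⟧` is the `h`-adic extension `A[[h]]`; the variable `X` plays the role of `h`. -/

section Hadic

variable {A B C : Type} [Ring A] [Algebra ℂ A] [Ring B] [Algebra ℂ B] [Ring C] [Algebra ℂ C]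

/-- `A[[h]]` is an algebra over `ℂ[[h]]`, also for noncommutative `A` (Cauchy product). -/
instance hadicAlgebra : Algebra ℂ⟦X⟧ A⟦X⟧ :=
  RingHom.toAlgebra' (PowerSeries.map (algebraMap ℂ A)) (by
    intro c a
    ext k
    rw [PowerSeries.coeff_mul, PowerSeries.coeff_mul, ← Finset.Nat.sum_antidiagonal_swap]
    refine Finset.sum_congr rfl fun p _ => ?_
    simpa using Algebra.commutes _ _)

theorem coeff_hadic_smul (c : ℂ⟦X⟧) (a : A⟦X⟧) (k : ℕ) :
    PowerSeries.coeff k (c • a) =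
      ∑ p ∈ Finset.HasAntidiagonal.antidiagonal k, PowerSeries.coeff p.1 c • PowerSeries.coeff p.2 a := by
  change PowerSeries.coeff k (PowerSeries.map (algebraMap ℂ A) c * a) = _
  rw [PowerSeries.coeff_mul]
  refine Finset.sum_congr rfl fun p _ => ?_
  rw [PowerSeries.coeff_map, Algebra.smul_def]

theorem coeff_complex_smul (c : ℂ) (a : A⟦X⟧) (k : ℕ) :
    PowerSeries.coeff k (c • a) = c • PowerSeries.coeff k a := rfl

/-- The constant series. -/
def hconst : A →ₗ[ℂ] A⟦X⟧ where
  toFun a := PowerSeries.C a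
  map_add' a b := map_add _ a b
  map_smul' c a := by
    ext k
    simp only [coeff_complex_smul, PowerSeries.coeff_C, RingHom.id_apply]
    split_ifs <;> simp

/-- Coefficientwise extension of a linear map `A → B` to `A[[h]] → B[[h]]`. -/
def hmap (φ : A →ₗ[ℂ] B) : A⟦X⟧ →ₗ[ℂ] B⟦X⟧ where
  toFun a := PowerSeries.mk fun k => φ (PowerSeries.coeff k a)
  map_add' a b := by ext k; simp
  map_smul' c a := by ext k; simp

/-- The `h`-adically continuous, `ℂ[[h]]`-linear extension `A[[h]] → B[[h]]` of a linear map
`φ : A → B[[h]]`, that is `∑ aᵢ hⁱ ↦ ∑ φ(aᵢ) hⁱ`. -/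
def hextend (φ : A →ₗ[ℂ] B⟦X⟧) : A⟦X⟧ →ₗ[ℂ] B⟦X⟧ where
  toFun a := PowerSeries.mk fun k =>
    ∑ p ∈ Finset.HasAntidiagonal.antidiagonal k, PowerSeries.coeff p.2 (φ (PowerSeries.coeff p.1 a))
  map_add' a b := by ext k; simp [Finset.sum_add_distrib]
  map_smul' c a := by ext k; simp [Finset.smul_sum]

/-- The `h`-adically continuous, `ℂ[[h]]`-bilinear extension `A[[h]] × B[[h]] → C[[h]]` of a
bilinear map `β : A × B → C[[h]]`. -/
def hextend₂ (β : A →ₗ[ℂ] B →ₗ[ℂ] C⟦X⟧) (a : A⟦X⟧) (b : B⟦X⟧) : C⟦X⟧ :=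
  PowerSeries.mk fun k => ∑ p ∈ Finset.HasAntidiagonal.antidiagonal k, ∑ q ∈ Finset.HasAntidiagonal.antidiagonal p.2,
    PowerSeries.coeff q.2 (β (PowerSeries.coeff p.1 a) (PowerSeries.coeff q.1 b))

theorem hmap_add (φ ψ : A →ₗ[ℂ] B) (a : A⟦X⟧) : hmap (φ + ψ) a = hmap φ a + hmap ψ a := by
  ext k; simp [hmap]

theorem hmap_smul (c : ℂ) (φ : A →ₗ[ℂ] B) (a : A⟦X⟧) : hmap (c • φ) a = c • hmap φ a := by
  ext k; simp [hmap]

theorem hextend_add (φ ψ : A →ₗ[ℂ] B⟦X⟧) (a : A⟦X⟧) :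
    hextend (φ + ψ) a = hextend φ a + hextend ψ a := by
  ext k; simp [hextend, Finset.sum_add_distrib]

theorem hextend_smul (c : ℂ) (φ : A →ₗ[ℂ] B⟦X⟧) (a : A⟦X⟧) :
    hextend (c • φ) a = c • hextend φ a := by
  ext k; simp [hextend, Finset.smul_sum]

end Hadic

/-! ### The Lie algebra `𝔦𝔤𝔩(n)` -/

/-- The inhomogeneous general linear Lie algebra `𝔤𝔩(n) ⋉ 𝔱ⁿ` over `ℂ`. -/
@[ext] structure Igl (n : ℕ) where
  /-- the homogeneous part -/
  gl : Matrix (Fin n) (Fin n) ℂ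
  /-- the translation part -/
  tr : Fin n → ℂ

namespace Igl

variable {n : ℕ}

/-- The underlying vector space is the product. -/
def toProd (n : ℕ) : Igl n ≃ Matrix (Fin n) (Fin n) ℂ × (Fin n → ℂ) where
  toFun a := (a.gl, a.tr)
  invFun a := ⟨a.1, a.2⟩
  left_inv _ := rfl
  right_inv _ := rfl

instance : AddCommGroup (Igl n) := (toProd n).addCommGroup

instance : Module ℂ (Igl n) := (toProd n).module ℂ

/-- `𝔤𝔩(n)` acts on the translations by the dual of its defining representation. -/
instance : Bracket (Igl n) (Igl n) where
  bracket a b := ⟨a.gl * b.gl - b.gl * a.gl, b.gl.transpose.mulVec a.tr - a.gl.transpose.mulVec b.tr⟩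

@[simp] theorem zero_gl : (0 : Igl n).gl = 0 := rfl
@[simp] theorem zero_tr : (0 : Igl n).tr = 0 := rfl
@[simp] theorem add_gl (a b : Igl n) : (a + b).gl = a.gl + b.gl := rfl
@[simp] theorem add_tr (a b : Igl n) : (a + b).tr = a.tr + b.tr := rfl
@[simp] theorem smul_gl (c : ℂ) (a : Igl n) : (c • a).gl = c • a.gl := rfl
@[simp] theorem smul_tr (c : ℂ) (a : Igl n) : (c • a).tr = c • a.tr := rfl
@[simp] theorem lie_gl (a b : Igl n) : ⁅a, b⁆.gl = a.gl * b.gl - b.gl * a.gl := rfl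
@[simp] theorem lie_tr (a b : Igl n) :
    ⁅a, b⁆.tr = b.gl.transpose.mulVec a.tr - a.gl.transpose.mulVec b.tr := rfl

instance : LieRing (Igl n) where
  add_lie a b c := by
    ext1
    · simp only [lie_gl, add_gl]; noncomm_ring
    · simp only [lie_tr, add_gl, add_tr, Matrix.transpose_add, Matrix.add_mulVec,
        Matrix.mulVec_add]; abel
  lie_add a b c := by
    ext1
    · simp only [lie_gl, add_gl]; noncomm_ring
    · simp only [lie_tr, add_gl, add_tr, Matrix.transpose_add, Matrix.add_mulVec,
        Matrix.mulVec_add]; abel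
  lie_self a := by ext1 <;> simp
  leibniz_lie a b c := by
    ext1
    · simp only [lie_gl, add_gl]; noncomm_ring
    · simp only [lie_tr, lie_gl, add_tr, Matrix.transpose_sub, Matrix.transpose_mul,
        Matrix.sub_mulVec, Matrix.mulVec_sub, Matrix.mulVec_mulVec]; abel

instance : LieAlgebra ℂ (Igl n) where
  lie_smul c a b := by
    ext1
    · simp [smul_sub]
    · simp [smul_sub, Matrix.mulVec_smul, Matrix.smul_mulVec]

/-- The generator `L^μ_ν`. -/
def L (μ ν : Fin n) : Igl n := ⟨-Complex.I • Matrix.single μ ν 1, 0⟩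

/-- The generator `P_μ`. -/
def P (μ : Fin n) : Igl n := ⟨0, Pi.single μ 1⟩

/-- `[L^μ_ν, L^ρ_l] = -i δ^ρ_ν L^μ_l + i δ^μ_l L^ρ_ν`. -/
theorem lie_L_L (μ ν ρ l : Fin n) :
    ⁅L μ ν, L ρ l⁆ = (if ρ = ν then -Complex.I else 0) • L μ l +
      (if μ = l then Complex.I else 0) • L ρ ν := by
  ext1
  · simp only [L, lie_gl, add_gl, smul_gl, Matrix.smul_mul, Matrix.mul_smul, smul_smul]
    by_cases h1 : ρ = ν <;> by_cases h2 : μ = l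
    · subst h1 h2; simp [sub_eq_add_neg]
    · subst h1; simp [h2, Matrix.single_mul_single_of_ne, Ne.symm h2]
    · subst h2; simp [h1, Matrix.single_mul_single_of_ne, Ne.symm h1]
    · simp [h1, h2, Matrix.single_mul_single_of_ne, Ne.symm h1, Ne.symm h2]
  · simp only [L, lie_tr, add_tr, smul_tr]; simp

/-- `[L^μ_ν, P_l] = i δ^μ_l P_ν`. -/
theorem lie_L_P (μ ν l : Fin n) :
    ⁅L μ ν, P l⁆ = (if μ = l then Complex.I else 0) • P ν := by
  ext1
  · simp only [L, P, lie_gl, smul_gl]; simp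
  · ext k
    by_cases h : μ = l
    · subst h
      simp [L, P, Matrix.single_apply, Pi.single_apply, eq_comm]
    · simp [L, P, h]

/-- `[P_μ, P_ν] = 0`. -/
theorem lie_P_P (μ ν : Fin n) : ⁅P μ, P ν⁆ = (0 : Igl n) := by
  ext1
  · simp [P]
  · simp only [P, lie_tr, Matrix.transpose_zero, Matrix.zero_mulVec, sub_zero, zero_tr]

end Igl

attribute [local instance 100] LieRing.ofAssociativeRing
attribute [local instance 100] LieAlgebra.ofAssociativeAlgebra

/-! ### The Hopf algebra `U(𝔦𝔤𝔩(n))` and its action on polynomials -/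

/-- The enveloping algebra `U(𝔦𝔤𝔩(n))`. -/
abbrev U (n : ℕ) : Type := UniversalEnvelopingAlgebra ℂ (Igl n)

/-- The inclusion `𝔦𝔤𝔩(n) → U(𝔦𝔤𝔩(n))`. -/
def inc (n : ℕ) : Igl n →ₗ⁅ℂ⁆ U n := UniversalEnvelopingAlgebra.ι ℂ

/-- The primitive coproduct `Δ(u) = u ⊗ 1 + 1 ⊗ u`, `u ∈ 𝔦𝔤𝔩(n)`. -/
def coproduct (n : ℕ) : U n →ₐ[ℂ] U n ⊗[ℂ] U n :=
  UniversalEnvelopingAlgebra.lift ℂ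
    { toFun := fun u => inc n u ⊗ₜ[ℂ] 1 + 1 ⊗ₜ[ℂ] inc n u
      map_add' := fun u v => by
        rw [map_add, TensorProduct.add_tmul, TensorProduct.tmul_add]; abel
      map_smul' := fun c u => by
        simp [TensorProduct.smul_tmul', TensorProduct.tmul_smul, smul_add]
      map_lie' := fun {u v} => by
        simp only [LieHom.map_lie, LieRing.of_associative_ring_bracket, mul_add, add_mul,
          Algebra.TensorProduct.tmul_mul_tmul, one_mul, mul_one, TensorProduct.sub_tmul,
          TensorProduct.tmul_sub]
        abel }

/-- The counit, `ε(u) = 0` for `u ∈ 𝔦𝔤𝔩(n)`. -/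
def counit (n : ℕ) : U n →ₐ[ℂ] ℂ := UniversalEnvelopingAlgebra.lift ℂ 0

/-- The coordinate algebra `𝔛ⁿ = ℂ[x⁰, …, xⁿ⁻¹]`. -/
abbrev Coord (n : ℕ) : Type := MvPolynomial (Fin n) ℂ

/-- The derivation by which `u ∈ 𝔦𝔤𝔩(n)` acts on `𝔛ⁿ`. -/
def vectorField {n : ℕ} (u : Igl n) : Derivation ℂ (Coord n) (Coord n) :=
  MvPolynomial.mkDerivation ℂ fun ρ =>
    ∑ μ, u.gl μ ρ • MvPolynomial.X μ + MvPolynomial.C (-Complex.I * u.tr ρ)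

theorem vectorField_X {n : ℕ} (u : Igl n) (ρ : Fin n) :
    vectorField u (MvPolynomial.X ρ) =
      ∑ μ, u.gl μ ρ • MvPolynomial.X μ + MvPolynomial.C (-Complex.I * u.tr ρ) :=
  MvPolynomial.mkDerivation_X _ _ _

theorem vectorField_add {n : ℕ} (u v : Igl n) :
    vectorField (u + v) = vectorField u + vectorField v := by
  apply MvPolynomial.derivation_ext
  intro ρ
  simp only [Derivation.add_apply, vectorField_X, Igl.add_gl, Igl.add_tr, Matrix.add_apply,
    Pi.add_apply, add_smul, Finset.sum_add_distrib, mul_add, map_add]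
  abel

theorem vectorField_smul {n : ℕ} (c : ℂ) (u : Igl n) :
    vectorField (c • u) = c • vectorField u := by
  apply MvPolynomial.derivation_ext
  intro ρ
  simp only [Derivation.smul_apply, vectorField_X, Igl.smul_gl, Igl.smul_tr, Matrix.smul_apply,
    Pi.smul_apply, smul_eq_mul, smul_add, Finset.smul_sum, MvPolynomial.smul_eq_C_mul,
    map_mul]
  congr 1
  · exact Finset.sum_congr rfl fun μ _ => mul_assoc _ _ _
  · ring

theorem vectorField_comp_X {n : ℕ} (u v : Igl n) (ρ : Fin n) :
    vectorField u (vectorField v (MvPolynomial.X ρ)) =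
      ∑ μ, (u.gl * v.gl) μ ρ • MvPolynomial.X μ +
        MvPolynomial.C (-Complex.I * v.gl.transpose.mulVec u.tr ρ) := by
  have h1 : ∀ c : ℂ, vectorField u (MvPolynomial.C c) = 0 := fun c =>
    (vectorField u).map_algebraMap c
  rw [vectorField_X]
  simp only [map_add, map_sum, Derivation.map_smul, vectorField_X, h1, add_zero, smul_add,
    Finset.sum_add_distrib]
  congr 1
  · simp only [Finset.smul_sum, smul_smul, Matrix.mul_apply, Finset.sum_smul]
    rw [Finset.sum_comm]
    simp only [mul_comm]
  · simp only [Matrix.mulVec, dotProduct, Matrix.transpose_apply, Finset.mul_sum, map_sum,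
      MvPolynomial.smul_eq_C_mul, ← map_mul]
    refine Finset.sum_congr rfl fun μ _ => ?_
    congr 1
    ring

theorem vectorField_lie {n : ℕ} (u v : Igl n) :
    vectorField ⁅u, v⁆ = ⁅vectorField u, vectorField v⁆ := by
  apply MvPolynomial.derivation_ext
  intro ρ
  rw [Derivation.commutator_apply, vectorField_comp_X, vectorField_comp_X, vectorField_X]
  simp only [Igl.lie_gl, Igl.lie_tr, Matrix.sub_apply, Pi.sub_apply, sub_smul,
    Finset.sum_sub_distrib, mul_sub, map_sub]
  abel

/-- The Hopf action `▷` of `U(𝔦𝔤𝔩(n))` on `𝔛ⁿ`; on generators it is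
`P_μ ▷ x^ν = -i δ_μ^ν`, `L^μ_ν ▷ x^ρ = -i δ_ν^ρ x^μ`. -/
def action (n : ℕ) : U n →ₐ[ℂ] Module.End ℂ (Coord n) :=
  UniversalEnvelopingAlgebra.lift ℂ
    { toFun := fun u => (vectorField u : Coord n →ₗ[ℂ] Coord n)
      map_add' := fun u v => by rw [vectorField_add]; rfl
      map_smul' := fun c u => by rw [vectorField_smul]; rfl
      map_lie' := fun {u v} => by rw [vectorField_lie, Derivation.commutator_coe_linear_map] }

theorem action_inc {n : ℕ} (u : Igl n) (f : Coord n) :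
    action n (inc n u) f = vectorField u f := by
  unfold action inc
  rw [UniversalEnvelopingAlgebra.lift_ι_apply]
  rfl

/-- `P_μ ▷ x^ν = -i δ_μ^ν`. -/
theorem action_P_X {n : ℕ} (μ ν : Fin n) :
    action n (inc n (Igl.P μ)) (MvPolynomial.X ν) =
      MvPolynomial.C (if μ = ν then -Complex.I else 0) := by
  rw [action_inc, vectorField_X]
  by_cases h : μ = ν
  · subst h; simp [Igl.P]
  · simp [Igl.P, h, Ne.symm h]

/-- `L^μ_ν ▷ x^ρ = -i δ_ν^ρ x^μ`. -/
theorem action_L_X {n : ℕ} (μ ν ρ : Fin n) :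
    action n (inc n (Igl.L μ ν)) (MvPolynomial.X ρ) =
      (if ν = ρ then -Complex.I else 0) • MvPolynomial.X μ := by
  rw [action_inc, vectorField_X, Finset.sum_eq_single μ]
  · by_cases h : ν = ρ
    · subst h; simp [Igl.L]
    · simp [Igl.L, h]
  · intro σ _ hσ
    simp [Igl.L, Ne.symm hσ]
  · simp

/-- For fixed `f`, the linear map `u ↦ u ▷ f`. -/
def actOn {n : ℕ} (f : Coord n) : U n →ₗ[ℂ] Coord n := (action n).toLinearMap.flip f

theorem actOn_add {n : ℕ} (f g : Coord n) : actOn (f + g) = actOn f + actOn g :=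
  map_add _ f g

theorem actOn_smul {n : ℕ} (c : ℂ) (f : Coord n) : actOn (c • f) = c • actOn f :=
  map_smul _ c f

/-- The momentum algebra `𝔗ⁿ = ℂ[P₀, …, Pₙ₋₁]`, as a subalgebra of `U(𝔦𝔤𝔩(n))`. -/
def momenta (n : ℕ) : Subalgebra ℂ (U n) :=
  Algebra.adjoin ℂ (Set.range fun μ : Fin n => inc n (Igl.P μ))

/-! ### The Weyl algebra and the Heisenberg realization -/

/-- The generators of the Weyl algebra. -/
inductive WeylGen (n : ℕ) : Type
  | x (μ : Fin n)
  | P (μ : Fin n)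

/-- The relations `[x^μ, x^ν] = 0`, `[P_μ, P_ν] = 0`, `[P_μ, x^ν] = -i δ_μ^ν`. -/
inductive WeylRel (n : ℕ) : FreeAlgebra ℂ (WeylGen n) → FreeAlgebra ℂ (WeylGen n) → Prop
  | xx (μ ν : Fin n) : WeylRel n
      (FreeAlgebra.ι ℂ (.x μ) * FreeAlgebra.ι ℂ (.x ν))
      (FreeAlgebra.ι ℂ (.x ν) * FreeAlgebra.ι ℂ (.x μ))
  | PP (μ ν : Fin n) : WeylRel n
      (FreeAlgebra.ι ℂ (.P μ) * FreeAlgebra.ι ℂ (.P ν))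
      (FreeAlgebra.ι ℂ (.P ν) * FreeAlgebra.ι ℂ (.P μ))
  | Px (μ ν : Fin n) : WeylRel n
      (FreeAlgebra.ι ℂ (.P μ) * FreeAlgebra.ι ℂ (.x ν))
      (FreeAlgebra.ι ℂ (.x ν) * FreeAlgebra.ι ℂ (.P μ) +
        algebraMap ℂ _ (if μ = ν then -Complex.I else 0))

/-- The Weyl algebra `𝔚ⁿ`. -/
def Weyl (n : ℕ) : Type := RingQuot (WeylRel n)

namespace Weyl

variable {n : ℕ}

instance : Ring (Weyl n) := inferInstanceAs (Ring (RingQuot (WeylRel n)))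

instance : Algebra ℂ (Weyl n) := inferInstanceAs (Algebra ℂ (RingQuot (WeylRel n)))

/-- The quotient map. -/
def quot (n : ℕ) : FreeAlgebra ℂ (WeylGen n) →ₐ[ℂ] Weyl n := RingQuot.mkAlgHom ℂ (WeylRel n)

theorem quot_rel {a b : FreeAlgebra ℂ (WeylGen n)} (h : WeylRel n a b) : quot n a = quot n b :=
  RingQuot.mkAlgHom_rel ℂ h

/-- The generator `x^μ` of the Weyl algebra. -/
def x (μ : Fin n) : Weyl n := quot n (FreeAlgebra.ι ℂ (.x μ))

/-- The generator `P_μ` of the Weyl algebra. -/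
def P (μ : Fin n) : Weyl n := quot n (FreeAlgebra.ι ℂ (.P μ))

theorem x_mul_x (μ ν : Fin n) : x μ * x ν = x ν * x μ := by
  simpa only [map_mul, x] using quot_rel (WeylRel.xx μ ν)

theorem P_mul_P (μ ν : Fin n) : P μ * P ν = P ν * P μ := by
  simpa only [map_mul, P] using quot_rel (WeylRel.PP μ ν)

theorem P_mul_x (μ ν : Fin n) :
    P μ * x ν = x ν * P μ + algebraMap ℂ (Weyl n) (if μ = ν then -Complex.I else 0) := by
  simpa only [map_mul, map_add, AlgHom.commutes, x, P] using quot_rel (WeylRel.Px μ ν)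

/-- The embedding `𝔛ⁿ → 𝔚ⁿ`, `x^μ ↦ x^μ`. -/
def ofCoord (n : ℕ) : Coord n →ₐ[ℂ] Weyl n :=
  letI : CommRing (Algebra.adjoin ℂ (Set.range (x : Fin n → Weyl n))) :=
    { (Algebra.adjoin ℂ (Set.range (x : Fin n → Weyl n))).toRing with
      mul_comm := (Algebra.isMulCommutative_adjoin ℂ (by
        rintro _ ⟨μ, rfl⟩ _ ⟨ν, rfl⟩
        exact x_mul_x μ ν)).is_comm.comm }
  (Algebra.adjoin ℂ (Set.range (x : Fin n → Weyl n))).val.comp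
    (MvPolynomial.aeval fun μ => ⟨x μ, Algebra.subset_adjoin ⟨μ, rfl⟩⟩)

theorem ofCoord_X (μ : Fin n) : ofCoord n (MvPolynomial.X μ) = x μ := by
  unfold ofCoord
  simp

theorem lie_P_P (μ ν : Fin n) : ⁅P μ, P ν⁆ = (0 : Weyl n) := by
  rw [LieRing.of_associative_ring_bracket, P_mul_P, sub_self]

theorem lie_xP_P (μ ν l : Fin n) :
    ⁅x μ * P ν, P l⁆ = (if l = μ then Complex.I else 0) • (P ν : Weyl n) := by
  have h : P l * (x μ * P ν) =
      x μ * P ν * P l + algebraMap ℂ (Weyl n) (if l = μ then -Complex.I else 0) * P ν := by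
    rw [← mul_assoc, P_mul_x, add_mul, mul_assoc, mul_assoc, P_mul_P l ν]
  rw [LieRing.of_associative_ring_bracket, h, ← Algebra.smul_def]
  split_ifs <;> simp

theorem lie_xP_xP (μ ν ρ l : Fin n) :
    ⁅x μ * P ν, x ρ * P l⁆ = (if ν = ρ then -Complex.I else 0) • (x μ * P l : Weyl n) +
      (if l = μ then Complex.I else 0) • (x ρ * P ν) := by
  have h : ∀ α β γ δ : Fin n, (x α * P β) * (x γ * P δ) = x α * x γ * (P β * P δ) +
      (if β = γ then -Complex.I else 0) • (x α * P δ : Weyl n) := by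
    intro α β γ δ
    rw [mul_assoc, ← mul_assoc (P β), P_mul_x, add_mul, mul_add, Algebra.smul_def,
      Algebra.left_comm]
    simp only [mul_assoc]
  rw [LieRing.of_associative_ring_bracket, h, h, x_mul_x ρ μ, P_mul_P l ν, add_sub_add_left_eq_sub]
  split_ifs <;> simp

theorem lie_gl_gl (A B : Matrix (Fin n) (Fin n) ℂ) :
    ⁅∑ μ, ∑ ν, (Complex.I * A μ ν) • (x μ * P ν : Weyl n),
      ∑ μ, ∑ ν, (Complex.I * B μ ν) • (x μ * P ν : Weyl n)⁆ =
    ∑ μ, ∑ ν, (Complex.I * (A * B - B * A) μ ν) • (x μ * P ν) := by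
  have h : ∀ μ ν ρ l : Fin n,
      (Complex.I * A μ ν) • (Complex.I * B ρ l) • ⁅x μ * P ν, (x ρ * P l : Weyl n)⁆ =
      (if ν = ρ then (Complex.I * (A μ ν * B ρ l)) • (x μ * P l : Weyl n) else 0) -
      (if l = μ then (Complex.I * (B ρ l * A μ ν)) • (x ρ * P ν : Weyl n) else 0) := by
    intro μ ν ρ l
    rw [lie_xP_xP, smul_smul, smul_add, smul_smul, smul_smul, sub_eq_add_neg]
    have e1 : Complex.I * A μ ν * (Complex.I * B ρ l) * -Complex.I =
        Complex.I * (A μ ν * B ρ l) := by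
      linear_combination (-Complex.I * A μ ν * B ρ l) * Complex.I_mul_I
    have e2 : Complex.I * A μ ν * (Complex.I * B ρ l) * Complex.I =
        -(Complex.I * (B ρ l * A μ ν)) := by
      linear_combination (Complex.I * A μ ν * B ρ l) * Complex.I_mul_I
    congr 1
    · split_ifs
      · rw [e1]
      · simp
    · split_ifs
      · rw [e2, neg_smul]
      · simp
  have h' : ⁅∑ μ, ∑ ν, (Complex.I * A μ ν) • (x μ * P ν : Weyl n),
      ∑ μ, ∑ ν, (Complex.I * B μ ν) • (x μ * P ν : Weyl n)⁆ =
      ∑ μ, ∑ ν, ∑ ρ, ∑ l,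
        (Complex.I * A μ ν) • (Complex.I * B ρ l) • ⁅x μ * P ν, (x ρ * P l : Weyl n)⁆ := by
    rw [sum_lie]
    refine Finset.sum_congr rfl fun μ _ => ?_
    rw [sum_lie]
    refine Finset.sum_congr rfl fun ν _ => ?_
    rw [lie_sum]
    refine Finset.sum_congr rfl fun ρ _ => ?_
    rw [lie_sum]
    refine Finset.sum_congr rfl fun l _ => ?_
    rw [smul_lie, lie_smul]
  rw [h']
  simp only [h, Finset.sum_sub_distrib, Matrix.sub_apply, mul_sub, sub_smul, Matrix.mul_apply,
    Finset.mul_sum, Finset.sum_smul]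
  congr 1
  · refine Finset.sum_congr rfl fun μ _ => ?_
    rw [Finset.sum_comm]
    simp only [Finset.sum_ite_irrel, Finset.sum_const_zero, Finset.sum_ite_eq',
      Finset.mem_univ, if_true]
    rw [Finset.sum_comm]
  · simp only [Finset.sum_ite_eq', Finset.mem_univ, if_true]
    rw [Finset.sum_comm]
    refine (Finset.sum_congr rfl fun ν _ => Finset.sum_comm).trans ?_
    rw [Finset.sum_comm]

theorem lie_gl_tr (A : Matrix (Fin n) (Fin n) ℂ) (v : Fin n → ℂ) :
    ⁅∑ μ, ∑ ν, (Complex.I * A μ ν) • (x μ * P ν : Weyl n), ∑ l, v l • (P l : Weyl n)⁆ =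
    -∑ ν, A.transpose.mulVec v ν • P ν := by
  have h : ∀ μ ν l : Fin n, (Complex.I * A μ ν) • v l • ⁅x μ * P ν, (P l : Weyl n)⁆ =
      -(if l = μ then (A μ ν * v l) • (P ν : Weyl n) else 0) := by
    intro μ ν l
    rw [lie_xP_P, smul_smul, smul_smul]
    have e1 : Complex.I * A μ ν * v l * Complex.I = -(A μ ν * v l) := by
      linear_combination (A μ ν * v l) * Complex.I_mul_I
    split_ifs
    · rw [e1, neg_smul]
    · simp
  have h' : ⁅∑ μ, ∑ ν, (Complex.I * A μ ν) • (x μ * P ν : Weyl n), ∑ l, v l • (P l : Weyl n)⁆ =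
      ∑ μ, ∑ ν, ∑ l, (Complex.I * A μ ν) • v l • ⁅x μ * P ν, (P l : Weyl n)⁆ := by
    rw [sum_lie]
    refine Finset.sum_congr rfl fun μ _ => ?_
    rw [sum_lie]
    refine Finset.sum_congr rfl fun ν _ => ?_
    rw [lie_sum]
    refine Finset.sum_congr rfl fun l _ => ?_
    rw [smul_lie, lie_smul]
  rw [h']
  simp only [h, Finset.sum_neg_distrib, Matrix.mulVec, dotProduct, Matrix.transpose_apply,
    Finset.sum_smul, Finset.sum_ite_eq', Finset.mem_univ, if_true]
  rw [Finset.sum_comm]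

/-- The Lie algebra homomorphism `𝔦𝔤𝔩(n) → 𝔚ⁿ` with `P_μ ↦ P_μ`, `L^μ_ν ↦ x^μ P_ν`. -/
def heisenbergLie (n : ℕ) : Igl n →ₗ⁅ℂ⁆ Weyl n where
  toFun u := ∑ μ, ∑ ν, (Complex.I * u.gl μ ν) • (x μ * P ν) + ∑ ν, u.tr ν • P ν
  map_add' u v := by
    simp only [Igl.add_gl, Igl.add_tr, Matrix.add_apply, Pi.add_apply, mul_add, add_smul,
      Finset.sum_add_distrib]
    abel
  map_smul' c u := by
    simp only [Igl.smul_gl, Igl.smul_tr, Matrix.smul_apply, Pi.smul_apply, smul_eq_mul, smul_add,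
      Finset.smul_sum, smul_smul, RingHom.id_apply, mul_left_comm]
  map_lie' {u v} := by
    have h : ⁅∑ l, u.tr l • (P l : Weyl n), ∑ l, v.tr l • (P l : Weyl n)⁆ = 0 := by
      simp only [sum_lie, lie_sum, smul_lie, lie_smul, lie_P_P, smul_zero, Finset.sum_const_zero]
    rw [add_lie, lie_add, lie_add, lie_gl_gl, lie_gl_tr, h,
      ← lie_skew (∑ l, u.tr l • (P l : Weyl n)), lie_gl_tr]
    simp only [Igl.lie_gl, Igl.lie_tr, Pi.sub_apply, sub_smul, Finset.sum_sub_distrib]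
    abel

/-- The Heisenberg realization `U(𝔦𝔤𝔩(n)) → 𝔚ⁿ`. -/
def heisenberg (n : ℕ) : U n →ₐ[ℂ] Weyl n :=
  UniversalEnvelopingAlgebra.lift ℂ (heisenbergLie n)

theorem heisenberg_P (μ : Fin n) : heisenberg n (inc n (Igl.P μ)) = P μ := by
  unfold heisenberg inc
  rw [UniversalEnvelopingAlgebra.lift_ι_apply]
  simp [heisenbergLie, Igl.P, Pi.single_apply]

theorem heisenberg_L (μ ν : Fin n) : heisenberg n (inc n (Igl.L μ ν)) = x μ * P ν := by
  unfold heisenberg inc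
  rw [UniversalEnvelopingAlgebra.lift_ι_apply]
  simp [heisenbergLie, Igl.L, Matrix.single_apply, ite_and]

/-- The Heisenberg realization of the smash product `𝔛ⁿ ⋊ U(𝔦𝔤𝔩(n)) → 𝔚ⁿ`,
`f ⊗ u ↦ f · heisenberg u`. -/
def realize (n : ℕ) : Coord n ⊗[ℂ] U n →ₗ[ℂ] Weyl n :=
  LinearMap.mul' ℂ (Weyl n) ∘ₗ
    TensorProduct.map (ofCoord n).toLinearMap (heisenberg n).toLinearMap

end Weyl

/-! ### Drinfeld twists and the deformed structures -/

section Twist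

variable {n : ℕ}

/-- `F ∈ (U ⊗ U)[[h]]` is a Drinfeld twist: it is invertible, congruent to `1 ⊗ 1` modulo `h`,
satisfies the 2-cocycle condition `F₁₂ (Δ ⊗ id) F = F₂₃ (id ⊗ Δ) F`
and is normalized, `(ε ⊗ id) F = 1 = (id ⊗ ε) F`. -/
structure IsTwist (F : ((U n ⊗[ℂ] U n)⟦X⟧)ˣ) : Prop where
  constantCoeff : PowerSeries.constantCoeff (F : (U n ⊗[ℂ] U n)⟦X⟧) = 1
  cocycle :
    PowerSeries.map (((Algebra.TensorProduct.assoc ℂ ℂ ℂ (U n) (U n) (U n)).toAlgHom.comp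
        Algebra.TensorProduct.includeLeft : U n ⊗[ℂ] U n →ₐ[ℂ] U n ⊗[ℂ] (U n ⊗[ℂ] U n)) :
          U n ⊗[ℂ] U n →+* U n ⊗[ℂ] (U n ⊗[ℂ] U n)) F *
      PowerSeries.map (((Algebra.TensorProduct.assoc ℂ ℂ ℂ (U n) (U n) (U n)).toAlgHom.comp
        (Algebra.TensorProduct.map (coproduct n) (AlgHom.id ℂ (U n))) :
          U n ⊗[ℂ] U n →ₐ[ℂ] U n ⊗[ℂ] (U n ⊗[ℂ] U n)) :
          U n ⊗[ℂ] U n →+* U n ⊗[ℂ] (U n ⊗[ℂ] U n)) F =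
    PowerSeries.map ((Algebra.TensorProduct.includeRight :
          U n ⊗[ℂ] U n →ₐ[ℂ] U n ⊗[ℂ] (U n ⊗[ℂ] U n)) :
          U n ⊗[ℂ] U n →+* U n ⊗[ℂ] (U n ⊗[ℂ] U n)) F *
      PowerSeries.map ((Algebra.TensorProduct.map (AlgHom.id ℂ (U n)) (coproduct n) :
          U n ⊗[ℂ] U n →ₐ[ℂ] U n ⊗[ℂ] (U n ⊗[ℂ] U n)) :
          U n ⊗[ℂ] U n →+* U n ⊗[ℂ] (U n ⊗[ℂ] U n)) F
  counit_left :
    PowerSeries.map (((Algebra.TensorProduct.lid ℂ (U n)).toAlgHom.comp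
        (Algebra.TensorProduct.map (counit n) (AlgHom.id ℂ (U n))) :
          U n ⊗[ℂ] U n →ₐ[ℂ] U n) : U n ⊗[ℂ] U n →+* U n) F = 1
  counit_right :
    PowerSeries.map (((Algebra.TensorProduct.rid ℂ ℂ (U n)).toAlgHom.comp
        (Algebra.TensorProduct.map (AlgHom.id ℂ (U n)) (counit n)) :
          U n ⊗[ℂ] U n →ₐ[ℂ] U n) : U n ⊗[ℂ] U n →+* U n) F = 1

/-- The deformed coproduct `Δ^F(u) = F Δ(u) F⁻¹`. -/
def twistedCoproduct (F : ((U n ⊗[ℂ] U n)⟦X⟧)ˣ) : U n →ₗ[ℂ] (U n ⊗[ℂ] U n)⟦X⟧ :=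
  LinearMap.mulLeft ℂ (F : (U n ⊗[ℂ] U n)⟦X⟧) ∘ₗ
    LinearMap.mulRight ℂ ((F⁻¹ : ((U n ⊗[ℂ] U n)⟦X⟧)ˣ) : (U n ⊗[ℂ] U n)⟦X⟧) ∘ₗ
      hconst ∘ₗ (coproduct n).toLinearMap

/-- The star product `f ⋆ g = m (F⁻¹ ▷ (f ⊗ g))` of `f, g ∈ 𝔛ⁿ`; its `ℂ[[h]]`-bilinear extension
is the product of `𝔛ⁿ[[h]]^F`. -/
def starProduct (F : ((U n ⊗[ℂ] U n)⟦X⟧)ˣ) : Coord n →ₗ[ℂ] Coord n →ₗ[ℂ] (Coord n)⟦X⟧ :=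
  LinearMap.mk₂ ℂ
    (fun f g => hmap (LinearMap.mul' ℂ (Coord n) ∘ₗ TensorProduct.map (actOn f) (actOn g))
      ((F⁻¹ : ((U n ⊗[ℂ] U n)⟦X⟧)ˣ) : (U n ⊗[ℂ] U n)⟦X⟧))
    (fun f f' g => by
      rw [actOn_add, TensorProduct.map_add_left, LinearMap.comp_add, hmap_add])
    (fun c f g => by
      rw [actOn_smul, TensorProduct.map_smul_left, LinearMap.comp_smul, hmap_smul])
    (fun f g g' => by
      rw [actOn_add, TensorProduct.map_add_right, LinearMap.comp_add, hmap_add])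
    (fun c f g => by
      rw [actOn_smul, TensorProduct.map_smul_right, LinearMap.comp_smul, hmap_smul])

/-- The linear map `u ⊗ v ↦ (u ▷ g) ⊗ v`. -/
def actLeft (g : Coord n) : U n ⊗[ℂ] U n →ₗ[ℂ] Coord n ⊗[ℂ] U n :=
  TensorProduct.map (actOn g) LinearMap.id

theorem actLeft_add (f g : Coord n) : actLeft (f + g) = actLeft f + actLeft g := by
  rw [actLeft, actOn_add, TensorProduct.map_add_left]; rfl

theorem actLeft_smul (c : ℂ) (f : Coord n) : actLeft (c • f) = c • actLeft f := by
  rw [actLeft, actOn_smul, TensorProduct.map_smul_left]; rfl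

/-- The linear map `k ⊗ v ↦ k ⊗ v w`. -/
def mulMom (w : U n) : Coord n ⊗[ℂ] U n →ₗ[ℂ] Coord n ⊗[ℂ] U n :=
  TensorProduct.map LinearMap.id (LinearMap.mulRight ℂ w)

theorem mulMom_add (v w : U n) : mulMom (v + w) = mulMom v + mulMom w := by
  ext f u
  simp [mulMom, mul_add, TensorProduct.tmul_add]

theorem mulMom_smul (c : ℂ) (w : U n) : mulMom (c • w) = c • mulMom w := by
  ext f u
  simp [mulMom]

/-- The linear map `k ⊗ v ↦ (f ⋆ k) ⊗ v`. -/
def starLeft (F : ((U n ⊗[ℂ] U n)⟦X⟧)ˣ) (f : Coord n) :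
    Coord n ⊗[ℂ] U n →ₗ[ℂ] (Coord n ⊗[ℂ] U n)⟦X⟧ :=
  TensorProduct.lift (LinearMap.mk₂ ℂ
    (fun k v => hmap ((TensorProduct.mk ℂ (Coord n) (U n)).flip v) (starProduct F f k))
    (fun k k' v => by rw [map_add, map_add])
    (fun c k v => by rw [map_smul, map_smul])
    (fun k v v' => by rw [map_add, hmap_add])
    (fun c k v => by rw [map_smul, hmap_smul]))

theorem starLeft_add (F : ((U n ⊗[ℂ] U n)⟦X⟧)ˣ) (f g : Coord n) :
    starLeft F (f + g) = starLeft F f + starLeft F g := by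
  apply TensorProduct.ext'
  intro k v
  simp [starLeft]

theorem starLeft_smul (F : ((U n ⊗[ℂ] U n)⟦X⟧)ˣ) (c : ℂ) (f : Coord n) :
    starLeft F (c • f) = c • starLeft F f := by
  apply TensorProduct.ext'
  intro k v
  simp [starLeft]

/-- The product of pure tensors in the smash product `𝔛ⁿ[[h]]^F ⋊ U(𝔦𝔤𝔩(n))[[h]]^F`,
`(f ⊗ u) # (g ⊗ w) = f ⋆ (u₍₁₎ ▷ g) ⊗ u₍₂₎ w` with `u₍₁₎ ⊗ u₍₂₎ = Δ^F(u)`. -/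
def smashPure (F : ((U n ⊗[ℂ] U n)⟦X⟧)ˣ) (f : Coord n) (u : U n) (g : Coord n) (w : U n) :
    (Coord n ⊗[ℂ] U n)⟦X⟧ :=
  hmap (mulMom w) (hextend (starLeft F f) (hmap (actLeft g) (twistedCoproduct F u)))

/-- `smashPure` as a bilinear map on `𝔛ⁿ ⊗ U(𝔦𝔤𝔩(n))`. -/
def smashBilin (F : ((U n ⊗[ℂ] U n)⟦X⟧)ˣ) :
    Coord n ⊗[ℂ] U n →ₗ[ℂ] Coord n ⊗[ℂ] U n →ₗ[ℂ] (Coord n ⊗[ℂ] U n)⟦X⟧ :=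
  TensorProduct.lift (LinearMap.mk₂ ℂ
    (fun f u => TensorProduct.lift (LinearMap.mk₂ ℂ (fun g w => smashPure F f u g w)
      (fun g g' w => by simp only [smashPure, actLeft_add, hmap_add, map_add])
      (fun c g w => by simp only [smashPure, actLeft_smul, hmap_smul, map_smul])
      (fun g w w' => by simp only [smashPure, mulMom_add, hmap_add])
      (fun c g w => by simp only [smashPure, mulMom_smul, hmap_smul])))
    (fun f f' u => by
      apply TensorProduct.ext'
      intro g w
      simp [smashPure, starLeft_add, hextend_add])
    (fun c f u => by
      apply TensorProduct.ext'
      intro g w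
      simp [smashPure, starLeft_smul, hextend_smul])
    (fun f u u' => by
      apply TensorProduct.ext'
      intro g w
      simp [smashPure])
    (fun c f u => by
      apply TensorProduct.ext'
      intro g w
      simp [smashPure]))

/-- The product of the smash product `𝔛ⁿ[[h]]^F ⋊ U(𝔦𝔤𝔩(n))[[h]]^F`, whose underlying
`ℂ[[h]]`-module is `(𝔛ⁿ ⊗ U(𝔦𝔤𝔩(n)))[[h]]`. -/
def smash (F : ((U n ⊗[ℂ] U n)⟦X⟧)ˣ) (a b : (Coord n ⊗[ℂ] U n)⟦X⟧) : (Coord n ⊗[ℂ] U n)⟦X⟧ :=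
  hextend₂ (smashBilin F) a b

/-- The underlying `ℂ[[h]]`-module `(𝔛ⁿ ⊗ 𝔗ⁿ)[[h]]` of the deformed Weyl algebra
`𝔚ⁿ[[h]]^F = 𝔛ⁿ[[h]]^F ⋊ 𝔗ⁿ[[h]]^F`, inside `𝔛ⁿ[[h]]^F ⋊ U(𝔦𝔤𝔩(n))[[h]]^F`.
Its product is the restriction of `smash F`. -/
def deformedWeyl (n : ℕ) : Submodule ℂ⟦X⟧ (Coord n ⊗[ℂ] U n)⟦X⟧ where
  carrier := {a | ∀ k, PowerSeries.coeff k a ∈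
    LinearMap.range (TensorProduct.map (LinearMap.id : Coord n →ₗ[ℂ] Coord n)
      (momenta n).val.toLinearMap)}
  add_mem' {a b} ha hb k := by
    rw [map_add]; exact Submodule.add_mem _ (ha k) (hb k)
  zero_mem' k := by
    rw [map_zero]; exact Submodule.zero_mem _
  smul_mem' c a ha k := by
    rw [coeff_hadic_smul]
    exact Submodule.sum_mem _ fun p _ => Submodule.smul_mem _ _ (ha p.2)

theorem const_mem_deformedWeyl (f : Coord n) (p : momenta n) :
    hconst (f ⊗ₜ[ℂ] (p : U n)) ∈ deformedWeyl n := by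
  intro k
  change PowerSeries.coeff k (PowerSeries.C _) ∈ _
  rw [PowerSeries.coeff_C]
  split_ifs
  · exact ⟨f ⊗ₜ[ℂ] p, rfl⟩
  · exact Submodule.zero_mem _

/-- The element `f p = f ⊗ p` of the deformed Weyl algebra. -/
def tensor (f : Coord n) (p : momenta n) : deformedWeyl n :=
  ⟨hconst (f ⊗ₜ[ℂ] (p : U n)), const_mem_deformedWeyl f p⟩

/-- The momenta form a Hopf subalgebra of `U(𝔦𝔤𝔩(n))[[h]]^F`: the deformed coproduct maps `𝔗ⁿ`,
hence `𝔗ⁿ[[h]]`, to `(𝔗ⁿ ⊗ 𝔗ⁿ)[[h]]`. (Stability under the deformed antipode is then automatic,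
and is not required.) -/
def MomentaHopf (F : ((U n ⊗[ℂ] U n)⟦X⟧)ˣ) : Prop :=
  ∀ p ∈ momenta n, ∀ k, PowerSeries.coeff k (twistedCoproduct F p) ∈
    LinearMap.range (TensorProduct.map (momenta n).val.toLinearMap (momenta n).val.toLinearMap)

/-- The element `f̂ = (f̄^α ▷ f) · f̄_α` of `𝔛ⁿ[[h]] ⋊ U(𝔦𝔤𝔩(n))[[h]]`, where
`F⁻¹ = f̄^α ⊗ f̄_α`. -/
def hat (F : ((U n ⊗[ℂ] U n)⟦X⟧)ˣ) (f : Coord n) : (Coord n ⊗[ℂ] U n)⟦X⟧ :=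
  hmap (actLeft f) ((F⁻¹ : ((U n ⊗[ℂ] U n)⟦X⟧)ˣ) : (U n ⊗[ℂ] U n)⟦X⟧)

/-- The element `f̂` in the Heisenberg realization `L^μ_ν ↦ x^μ P_ν`. -/
def realizedHat (F : ((U n ⊗[ℂ] U n)⟦X⟧)ˣ) (f : Coord n) : (Weyl n)⟦X⟧ :=
  hmap (Weyl.realize n) (hat F f)

end Twist

end TwistedWeyl

end

/-!
Realize `U(𝔦𝔤𝔩(n))` and `𝔛ⁿ` in `𝔚ⁿ`. The realization is covariant: moving `u` past a function `f`
lets the first leg of `Δ u` act on `f`. For such a pair the cocycle condition on `F⁻¹` says exactly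
that `f ↦ f̂` turns the star product into the product of `𝔚ⁿ[[h]]`, and conjugating `Δ` by `F` is
what makes `u f̂` the sum of the `ĝ u₍₂₎` with `g = u₍₁₎ ▷ f`, where `Δ^F u = u₍₁₎ ⊗ u₍₂₎`. Hence
`f ⊗ u ↦ f̂ u` is multiplicative on the whole smash product.

Modulo `h` its restriction to `𝔛ⁿ ⊗ 𝔗ⁿ` is normal ordering `f ⊗ p ↦ f p`, whose inverse sends `w` to
the value at `1 ⊗ 1` of the action of `w` on symbols. A map that is bijective modulo `h` is
bijective, and a subalgebra that is everything modulo `h` is dense; the latter applies to the one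
generated by `x̂^μ` and `P_μ` because `x̂^μ ≡ x^μ`.
-/

noncomputable section

namespace TwistedWeyl

open PowerSeries Finset.HasAntidiagonal

section Hadic

variable {A B D : Type} [Ring A] [Algebra ℂ A] [Ring B] [Algebra ℂ B] [Ring D] [Algebra ℂ D]
  {E : Type} [Ring E] [Algebra ℂ E]

theorem X_hadic_smul (a : A⟦X⟧) : (X : ℂ⟦X⟧) • a = X * a := by
  rw [Algebra.smul_def]
  exact congrArg (· * a) (map_X (algebraMap ℂ A))

theorem hadic_ext {φ ψ : A⟦X⟧ →ₗ[ℂ⟦X⟧] B⟦X⟧} (h : ∀ a, φ (C a) = ψ (C a)) : φ = ψ := by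
  have coeff_sub_eq_zero : ∀ (k : ℕ) (a : A⟦X⟧), coeff k ((φ - ψ) a) = 0 := by
    intro k
    induction k with
    | zero =>
      intro a
      rw [a.eq_X_mul_shift_add_const, ← X_hadic_smul, map_add, map_smul, X_hadic_smul]
      simp [h]
    | succ k ih =>
      intro a
      rw [a.eq_X_mul_shift_add_const, ← X_hadic_smul, map_add, map_smul, X_hadic_smul, map_add,
        coeff_succ_X_mul, ih]
      simp [h]
  refine LinearMap.ext fun a => sub_eq_zero.1 (PowerSeries.ext fun k => ?_)
  rw [← LinearMap.sub_apply, coeff_sub_eq_zero, map_zero]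

theorem hadic_ext_tmul {φ ψ : (A ⊗[ℂ] B)⟦X⟧ →ₗ[ℂ⟦X⟧] D⟦X⟧}
    (h : ∀ a b, φ (C (a ⊗ₜ b)) = ψ (C (a ⊗ₜ b))) : φ = ψ :=
  hadic_ext fun t => by
    induction t using TensorProduct.induction_on with
    | zero => simp
    | tmul a b => exact h a b
    | add s t hs ht => rw [map_add, map_add, map_add, hs, ht]

theorem coeff_hmap (φ : A →ₗ[ℂ] B) (a : A⟦X⟧) (k : ℕ) : coeff k (hmap φ a) = φ (coeff k a) := by
  simp [hmap]

theorem coeff_hextend (φ : A →ₗ[ℂ] B⟦X⟧) (a : A⟦X⟧) (k : ℕ) :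
    coeff k (hextend φ a) = ∑ p ∈ antidiagonal k, coeff p.2 (φ (coeff p.1 a)) := by
  simp [hextend]

theorem hextend_C (φ : A →ₗ[ℂ] B⟦X⟧) (a : A) : hextend φ (C a) = φ a := by
  ext k
  rw [coeff_hextend, Finset.Nat.sum_antidiagonal_eq_sum_range_succ_mk, Finset.sum_range_succ']
  simp [coeff_succ_C]

theorem hextend_hadic_smul (φ : A →ₗ[ℂ] B⟦X⟧) (c : ℂ⟦X⟧) (a : A⟦X⟧) :
    hextend φ (c • a) = c • hextend φ a := by
  ext k
  simp only [coeff_hextend, coeff_hadic_smul, map_sum, map_smul, Finset.smul_sum,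
    coeff_complex_smul]
  rw [Finset.sum_sigma', Finset.sum_sigma']
  refine Finset.sum_nbij' (fun x => ⟨(x.2.1, x.2.2 + x.1.2), (x.2.2, x.1.2)⟩)
    (fun x => ⟨(x.1.1 + x.2.1, x.2.2), (x.1.1, x.2.1)⟩) ?_ ?_ ?_ ?_ ?_ <;>
  rintro ⟨⟨i, j⟩, ⟨l, m⟩⟩ <;>
  simp only [Finset.mem_sigma, mem_antidiagonal] <;>
  rintro ⟨rfl, rfl⟩ <;> simp [add_assoc]

/-- `hextend φ` as a `ℂ[[h]]`-linear map. -/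
def hextendLin (φ : A →ₗ[ℂ] B⟦X⟧) : A⟦X⟧ →ₗ[ℂ⟦X⟧] B⟦X⟧ where
  toFun := hextend φ
  map_add' := map_add _
  map_smul' := hextend_hadic_smul φ

theorem hextendLin_C (φ : A →ₗ[ℂ] B⟦X⟧) (a : A) : hextendLin φ (C a) = φ a :=
  hextend_C φ a

theorem hmap_id (a : A⟦X⟧) : hmap LinearMap.id a = a :=
  PowerSeries.ext fun k => coeff_hmap _ a k

theorem hmap_hmap (ψ : B →ₗ[ℂ] D) (φ : A →ₗ[ℂ] B) (a : A⟦X⟧) :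
    hmap ψ (hmap φ a) = hmap (ψ ∘ₗ φ) a := by
  ext k
  simp only [coeff_hmap, LinearMap.comp_apply]

theorem hmap_algHom (φ : A →ₐ[ℂ] B) (a : A⟦X⟧) :
    hmap φ.toLinearMap a = PowerSeries.map (φ : A →+* B) a := by
  ext k
  rw [coeff_hmap, coeff_map]
  rfl

theorem hextend_hmap (ψ : B →ₗ[ℂ] D⟦X⟧) (φ : A →ₗ[ℂ] B) (a : A⟦X⟧) :
    hextend ψ (hmap φ a) = hextend (ψ ∘ₗ φ) a := by
  ext k
  simp only [coeff_hextend, coeff_hmap, LinearMap.comp_apply]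

theorem hextend_mul_C (φ : A →ₗ[ℂ] B⟦X⟧) (a : A⟦X⟧) (b : B) :
    hextend φ a * C b = hextend (LinearMap.mulRight ℂ (C b) ∘ₗ φ) a := by
  ext k
  simp [coeff_hextend, coeff_mul_C, Finset.sum_mul]

theorem hextend_hmap_mul {φ : A →ₗ[ℂ] B⟦X⟧} {ψ : E →ₗ[ℂ] B} {z : E⟦X⟧} {p : A →ₗ[ℂ] E}
    (h : ∀ a, φ a = hmap ψ (z * C (p a))) (a : A⟦X⟧) :
    hextend φ a = hmap ψ (z * hmap p a) := by
  ext k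
  rw [coeff_hmap, coeff_mul, map_sum, ← Finset.Nat.sum_antidiagonal_swap, coeff_hextend]
  simp only [h, coeff_hmap, coeff_mul_C, Prod.fst_swap, Prod.snd_swap]

theorem hmap_mul_hmap {φ : A →ₗ[ℂ] D} {ψ : B →ₗ[ℂ] D} {χ : E →ₗ[ℂ] D} {p : A →ₗ[ℂ] E}
    {q : B →ₗ[ℂ] E} (h : ∀ a b, φ a * ψ b = χ (p a * q b)) (a : A⟦X⟧) (b : B⟦X⟧) :
    hmap φ a * hmap ψ b = hmap χ (hmap p a * hmap q b) := by
  ext k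
  simp only [coeff_hmap, coeff_mul, map_sum, h]

theorem map_hextend₂_eq_mul {β : A →ₗ[ℂ] A →ₗ[ℂ] A⟦X⟧} {Φ : A⟦X⟧ →ₗ[ℂ⟦X⟧] B⟦X⟧}
    (h : ∀ a b, Φ (β a b) = Φ (C a) * Φ (C b)) (a b : A⟦X⟧) :
    Φ (hextend₂ β a b) = Φ a * Φ b := by
  have left_C (a : A) : Φ ∘ₗ hextendLin (β a) = LinearMap.mulLeft ℂ⟦X⟧ (Φ (C a)) ∘ₗ Φ :=
    hadic_ext fun b => by simp [hextendLin_C, h]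
  let β_b : A →ₗ[ℂ] A⟦X⟧ :=
    { toFun a := hextend (β a) b
      map_add' a a' := by rw [map_add, hextend_add]
      map_smul' c a := by rw [map_smul, hextend_smul, RingHom.id_apply] }
  have right : Φ ∘ₗ hextendLin β_b = LinearMap.mulRight ℂ⟦X⟧ (Φ b) ∘ₗ Φ :=
    hadic_ext fun a => by
      rw [LinearMap.comp_apply, hextendLin_C]
      exact LinearMap.congr_fun (left_C a) b
  have hextend₂_eq : hextend₂ β a b = hextendLin β_b a := by
    ext k
    simp only [hextend₂, hextendLin, LinearMap.coe_mk, AddHom.coe_mk, coeff_hextend, coeff_mk, β_b]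
  rw [hextend₂_eq]
  exact LinearMap.congr_fun right a

/-- `S[[h]]`, the series in `A[[h]]` all of whose coefficients lie in the subspace `S` of `A`. -/
def hadicSubmodule (S : Submodule ℂ A) : Submodule ℂ A⟦X⟧ where
  carrier := {a | ∀ k, coeff k a ∈ S}
  add_mem' ha hb k := by
    rw [map_add]
    exact S.add_mem (ha k) (hb k)
  zero_mem' k := by
    rw [map_zero]
    exact S.zero_mem
  smul_mem' c a ha k := by
    rw [coeff_complex_smul]
    exact S.smul_mem c (ha k)

theorem hmap_mem_hadicSubmodule {S : Submodule ℂ A} {T : Submodule ℂ B} {φ : A →ₗ[ℂ] B}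
    (hφ : S ≤ T.comap φ) {a : A⟦X⟧} (ha : a ∈ hadicSubmodule S) : hmap φ a ∈ hadicSubmodule T :=
  fun k => by
    rw [coeff_hmap]
    exact hφ (ha k)

theorem hextend_mem_hadicSubmodule {S : Submodule ℂ A} {T : Submodule ℂ B} {φ : A →ₗ[ℂ] B⟦X⟧}
    (hφ : S ≤ (hadicSubmodule T).comap φ) {a : A⟦X⟧} (ha : a ∈ hadicSubmodule S) :
    hextend φ a ∈ hadicSubmodule T :=
  fun k => by
    rw [coeff_hextend]
    exact T.sum_mem fun p _ => hφ (ha p.1) p.2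

theorem hextend₂_mem_hadicSubmodule {S : Submodule ℂ A} {T : Submodule ℂ B} {V : Submodule ℂ D}
    {β : A →ₗ[ℂ] B →ₗ[ℂ] D⟦X⟧} (hβ : ∀ a ∈ S, ∀ b ∈ T, β a b ∈ hadicSubmodule V)
    {a : A⟦X⟧} (ha : a ∈ hadicSubmodule S) {b : B⟦X⟧} (hb : b ∈ hadicSubmodule T) :
    hextend₂ β a b ∈ hadicSubmodule V :=
  fun k => by
    rw [hextend₂, coeff_mk]
    exact V.sum_mem fun p _ => V.sum_mem fun q _ => hβ _ (ha p.1) _ (hb q.1) q.2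

theorem hextend_eq_iff (φ : A →ₗ[ℂ] B⟦X⟧) (a : A⟦X⟧) (b : B⟦X⟧) :
    hextend φ a = b ↔ ∀ k, constantCoeff (φ (coeff k a)) =
      coeff k b - ∑ i : Fin k, coeff (k - i) (φ (coeff i a)) := by
  have coeff_eq (k : ℕ) : coeff k (hextend φ a) =
      ∑ i : Fin k, coeff (k - i) (φ (coeff i a)) + constantCoeff (φ (coeff k a)) := by
    rw [coeff_hextend, Finset.Nat.sum_antidiagonal_eq_sum_range_succ_mk, Finset.sum_range_succ,
      Finset.sum_range, Nat.sub_self, coeff_zero_eq_constantCoeff_apply]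
  simp only [PowerSeries.ext_iff, coeff_eq, eq_sub_iff_add_eq']

/-- The coefficients of the solution `a` of `hextend φ a = b`, found recursively from a section
`σ` of the constant term of `φ`. -/
def hextendInv (φ : A →ₗ[ℂ] B⟦X⟧) (σ : B → A) (b : B⟦X⟧) : ℕ → A
  | k => σ (coeff k b - ∑ i : Fin k, coeff (k - i) (φ (hextendInv φ σ b i)))

theorem hextend_bijOn {S : Submodule ℂ A} {φ : A →ₗ[ℂ] B⟦X⟧}
    (hφ : Set.BijOn (fun a => constantCoeff (φ a)) S Set.univ) :
    Set.BijOn (hextend φ) (hadicSubmodule S) Set.univ := by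
  refine ⟨Set.mapsTo_univ _ _, fun a ha a' ha' h => PowerSeries.ext fun k => ?_, fun b _ => ?_⟩
  · induction k using Nat.strong_induction_on with
    | _ k ih =>
      refine hφ.injOn (ha k) (ha' k) ?_
      simp only [(hextend_eq_iff φ a _).1 rfl k, (hextend_eq_iff φ a' _).1 h.symm k,
        fun i : Fin k => ih i i.isLt]
  · choose σ hσ hφσ using fun b => hφ.surjOn (Set.mem_univ b)
    refine ⟨mk (hextendInv φ σ b), fun k => ?_, (hextend_eq_iff _ _ _).2 fun k => ?_⟩
    · rw [coeff_mk, hextendInv]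
      exact hσ _
    · simp only [coeff_mk]
      rw [hextendInv]
      exact hφσ _

theorem exists_mem_forall_lt_coeff_eq {S : Submodule ℂ⟦X⟧ A⟦X⟧}
    (hS : ∀ a, ∃ s ∈ S, constantCoeff s = a) (w : A⟦X⟧) (k : ℕ) :
    ∃ s ∈ S, ∀ j < k, coeff j w = coeff j s := by
  induction k generalizing w with
  | zero => exact ⟨0, S.zero_mem, fun j hj => absurd hj j.not_lt_zero⟩
  | succ k ih =>
    obtain ⟨s, hs, hsw⟩ := hS (constantCoeff w)
    obtain ⟨v, hv⟩ := X_dvd_iff.2 (show constantCoeff (w - s) = 0 by rw [map_sub, hsw, sub_self])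
    obtain ⟨t, ht, htv⟩ := ih v
    refine ⟨s + (X : ℂ⟦X⟧) • t, S.add_mem hs (S.smul_mem _ ht), fun j hj => ?_⟩
    rw [sub_eq_iff_eq_add'.1 hv, X_hadic_smul, map_add, map_add]
    cases j with
    | zero => rw [coeff_zero_X_mul, coeff_zero_X_mul]
    | succ j => rw [coeff_succ_X_mul, coeff_succ_X_mul, htv j (Nat.succ_lt_succ_iff.1 hj)]

theorem exists_mem_adjoin_constantCoeff_eq {T : Set A⟦X⟧}
    (hT : Algebra.adjoin ℂ (constantCoeff '' T) = ⊤) (a : A) :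
    ∃ s ∈ Algebra.adjoin ℂ⟦X⟧ T, constantCoeff s = a := by
  have ha : a ∈ Algebra.adjoin ℂ (constantCoeff '' T) := hT ▸ Algebra.mem_top
  induction ha using Algebra.adjoin_induction with
  | mem a ha =>
    obtain ⟨t, ht, rfl⟩ := ha
    exact ⟨t, Algebra.subset_adjoin ht, rfl⟩
  | algebraMap c =>
    refine ⟨algebraMap ℂ⟦X⟧ A⟦X⟧ (C c), Subalgebra.algebraMap_mem _ _, ?_⟩
    change constantCoeff (PowerSeries.map (algebraMap ℂ A) (C c)) = _
    simp
  | add a b _ _ iha ihb =>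
    obtain ⟨s, hs, rfl⟩ := iha
    obtain ⟨t, ht, rfl⟩ := ihb
    exact ⟨s + t, add_mem hs ht, map_add _ _ _⟩
  | mul a b _ _ iha ihb =>
    obtain ⟨s, hs, rfl⟩ := iha
    obtain ⟨t, ht, rfl⟩ := ihb
    exact ⟨s * t, mul_mem hs ht, map_mul _ _ _⟩

theorem exists_mem_adjoin_forall_lt_coeff_eq {T : Set A⟦X⟧}
    (hT : Algebra.adjoin ℂ (constantCoeff '' T) = ⊤) (w : A⟦X⟧) (k : ℕ) :
    ∃ s ∈ Algebra.adjoin ℂ⟦X⟧ T, ∀ j < k, coeff j w = coeff j s :=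
  exists_mem_forall_lt_coeff_eq (S := Subalgebra.toSubmodule (Algebra.adjoin ℂ⟦X⟧ T))
    (exists_mem_adjoin_constantCoeff_eq hT) w k

end Hadic

/-- An algebra `H` with a coproduct and a counit, its action `u ▷ f := act u f` on a module algebra
`A`, and representations `ι` of `A` and `π` of `H` in an algebra `R` that are covariant,
`π u * ι f = ι (u₍₁₎ ▷ f) * π u₍₂₎`, and hence assemble to a representation of the smash product
`A ⋊ H`. -/
structure CovariantRep (H A R : Type) [Ring H] [Algebra ℂ H] [Ring A] [Algebra ℂ A] [Ring R]
    [Algebra ℂ R] where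
  comul : H →ₐ[ℂ] H ⊗[ℂ] H
  counit : H →ₐ[ℂ] ℂ
  act : H →ₐ[ℂ] Module.End ℂ A
  ι : A →ₐ[ℂ] R
  π : H →ₐ[ℂ] R
  act_one (u : H) : act u 1 = counit u • 1
  act_mul (u : H) (f g : A) : act u (f * g) =
    LinearMap.mul' ℂ A
      (TensorProduct.map (act.toLinearMap.flip f) (act.toLinearMap.flip g) (comul u))
  π_mul_ι (u : H) (f : A) : π u * ι f =
    LinearMap.mul' ℂ R
      (TensorProduct.map (ι.toLinearMap ∘ₗ act.toLinearMap.flip f) π.toLinearMap (comul u))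

namespace CovariantRep

variable {H A R : Type} [Ring H] [Algebra ℂ H] [Ring A] [Algebra ℂ A] [Ring R] [Algebra ℂ R]
  (ρ : CovariantRep H A R)

/-- For fixed `f`, the linear map `u ↦ u ▷ f`. -/
def actOn (f : A) : H →ₗ[ℂ] A := ρ.act.toLinearMap.flip f

theorem actOn_apply (f : A) (u : H) : ρ.actOn f u = ρ.act u f := rfl

/-- The linear map `u ⊗ v ↦ (u ▷ f) (v ▷ g)`. -/
def actMul (f g : A) : H ⊗[ℂ] H →ₗ[ℂ] A :=
  LinearMap.mul' ℂ A ∘ₗ TensorProduct.map (ρ.actOn f) (ρ.actOn g)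

theorem actMul_tmul (f g : A) (u v : H) :
    ρ.actMul f g (u ⊗ₜ v) = ρ.act u f * ρ.act v g := rfl

/-- The representation `f ⊗ u ↦ ι f * π u` of the smash product `A ⋊ H`. -/
def realize : A ⊗[ℂ] H →ₗ[ℂ] R :=
  LinearMap.mul' ℂ R ∘ₗ TensorProduct.map ρ.ι.toLinearMap ρ.π.toLinearMap

theorem realize_tmul (f : A) (u : H) : ρ.realize (f ⊗ₜ u) = ρ.ι f * ρ.π u := rfl

/-- The linear map `u ⊗ v ↦ ι (u ▷ f) * π v`. -/
def eval (f : A) : H ⊗[ℂ] H →ₗ[ℂ] R :=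
  ρ.realize ∘ₗ TensorProduct.map (ρ.actOn f) LinearMap.id

theorem eval_tmul (f : A) (u v : H) : ρ.eval f (u ⊗ₜ v) = ρ.ι (ρ.act u f) * ρ.π v := rfl

theorem eval_add (f g : A) : ρ.eval (f + g) = ρ.eval f + ρ.eval g := by
  ext u v
  simp [eval_tmul, add_mul]

theorem eval_smul (c : ℂ) (f : A) : ρ.eval (c • f) = c • ρ.eval f := by
  ext u v
  simp [eval_tmul]

theorem eval_one_eq_counit (t : H ⊗[ℂ] H) :
    ρ.eval 1 t = ρ.π (Algebra.TensorProduct.lid ℂ H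
      (Algebra.TensorProduct.map ρ.counit (AlgHom.id ℂ H) t)) := by
  induction t using TensorProduct.induction_on with
  | zero => simp only [map_zero]
  | tmul u v => simp [eval_tmul, act_one]
  | add s t hs ht => simp only [map_add, hs, ht]

theorem eval_mul_tmul (f : A) (t : H ⊗[ℂ] H) (u v : H) :
    ρ.eval f (t * u ⊗ₜ v) = ρ.eval (ρ.act u f) t * ρ.π v := by
  induction t using TensorProduct.induction_on with
  | zero => simp only [zero_mul, map_zero]
  | tmul a b => simp [eval_tmul, mul_assoc]
  | add s t hs ht => simp only [add_mul, map_add, hs, ht]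

theorem eval_comul (f : A) (u : H) : ρ.eval f (ρ.comul u) = ρ.π u * ρ.ι f := by
  rw [π_mul_ι, eval, realize, LinearMap.comp_assoc, ← TensorProduct.map_comp, LinearMap.comp_id]
  rfl

theorem eval_comul_mul (f : A) (u : H) (t : H ⊗[ℂ] H) :
    ρ.eval f (ρ.comul u * t) = ρ.π u * ρ.eval f t := by
  induction t using TensorProduct.induction_on with
  | zero => simp only [mul_zero, map_zero]
  | tmul a b => rw [eval_mul_tmul, eval_comul, eval_tmul, mul_assoc]
  | add s t hs ht => simp only [mul_add, map_add, hs, ht]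

theorem actMul_comul (f g : A) (u : H) : ρ.actMul f g (ρ.comul u) = ρ.act u (f * g) :=
  (ρ.act_mul u f g).symm

theorem actMul_mul_tmul (f g : A) (t : H ⊗[ℂ] H) (u v : H) :
    ρ.actMul f g (t * u ⊗ₜ v) = ρ.actMul (ρ.act u f) (ρ.act v g) t := by
  induction t using TensorProduct.induction_on with
  | zero => simp only [zero_mul, map_zero]
  | tmul a b => simp [actMul_tmul]
  | add s t hs ht => simp only [add_mul, map_add, hs, ht]

theorem actMul_comul_mul (f g : A) (u : H) (t : H ⊗[ℂ] H) :
    ρ.actMul f g (ρ.comul u * t) = ρ.act u (ρ.actMul f g t) := by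
  induction t using TensorProduct.induction_on with
  | zero => simp only [mul_zero, map_zero]
  | tmul a b => rw [actMul_mul_tmul, actMul_comul, actMul_tmul]
  | add s t hs ht => simp only [mul_add, map_add, hs, ht]

/-- The map `t ↦ t ⊗ 1` into the triple tensor power. -/
def leg₁₂ (H : Type) [Ring H] [Algebra ℂ H] : H ⊗[ℂ] H →ₐ[ℂ] H ⊗[ℂ] (H ⊗[ℂ] H) :=
  (Algebra.TensorProduct.assoc ℂ ℂ ℂ H H H).toAlgHom.comp Algebra.TensorProduct.includeLeft

/-- The map `t ↦ 1 ⊗ t` into the triple tensor power. -/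
def leg₂₃ (H : Type) [Ring H] [Algebra ℂ H] : H ⊗[ℂ] H →ₐ[ℂ] H ⊗[ℂ] (H ⊗[ℂ] H) :=
  Algebra.TensorProduct.includeRight

/-- The map `Δ ⊗ id` into the triple tensor power. -/
def comulLeft : H ⊗[ℂ] H →ₐ[ℂ] H ⊗[ℂ] (H ⊗[ℂ] H) :=
  (Algebra.TensorProduct.assoc ℂ ℂ ℂ H H H).toAlgHom.comp
    (Algebra.TensorProduct.map ρ.comul (AlgHom.id ℂ H))

/-- The map `id ⊗ Δ` into the triple tensor power. -/
def comulRight : H ⊗[ℂ] H →ₐ[ℂ] H ⊗[ℂ] (H ⊗[ℂ] H) :=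
  Algebra.TensorProduct.map (AlgHom.id ℂ H) ρ.comul

/-- The linear map `u ⊗ v ⊗ w ↦ ι (u ▷ f) * ι (v ▷ g) * π w`. -/
def eval₂ (f g : A) : H ⊗[ℂ] (H ⊗[ℂ] H) →ₗ[ℂ] R :=
  LinearMap.mul' ℂ R ∘ₗ TensorProduct.map (ρ.ι.toLinearMap ∘ₗ ρ.actOn f) (ρ.eval g)

theorem eval₂_tmul (f g : A) (u : H) (t : H ⊗[ℂ] H) :
    ρ.eval₂ f g (u ⊗ₜ t) = ρ.ι (ρ.act u f) * ρ.eval g t := rfl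

theorem eval₂_assoc_tmul (f g : A) (t : H ⊗[ℂ] H) (v : H) :
    ρ.eval₂ f g (Algebra.TensorProduct.assoc ℂ ℂ ℂ H H H (t ⊗ₜ v)) =
      ρ.ι (ρ.actMul f g t) * ρ.π v := by
  induction t using TensorProduct.induction_on with
  | zero => simp only [TensorProduct.zero_tmul, map_zero, zero_mul]
  | tmul a b => simp [eval₂_tmul, eval_tmul, actMul_tmul, mul_assoc]
  | add s t hs ht => simp only [TensorProduct.add_tmul, map_add, add_mul, hs, ht]

theorem eval₂_comulLeft_mul_leg₁₂ (f g : A) (s t : H ⊗[ℂ] H) :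
    ρ.eval₂ f g (ρ.comulLeft s * leg₁₂ H t) = ρ.eval (ρ.actMul f g t) s := by
  induction s using TensorProduct.induction_on with
  | zero => simp only [map_zero, zero_mul]
  | tmul u v =>
    have merge_legs : ρ.comulLeft (u ⊗ₜ v) * leg₁₂ H t =
        Algebra.TensorProduct.assoc ℂ ℂ ℂ H H H ((ρ.comul u * t) ⊗ₜ v) := by
      simp [comulLeft, leg₁₂, ← map_mul]
    rw [merge_legs, eval₂_assoc_tmul, actMul_comul_mul, eval_tmul]
  | add s s' hs hs' => simp only [map_add, add_mul, hs, hs']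

theorem eval₂_comulRight_mul_leg₂₃ (f g : A) (s t : H ⊗[ℂ] H) :
    ρ.eval₂ f g (ρ.comulRight s * leg₂₃ H t) = ρ.eval f s * ρ.eval g t := by
  induction s using TensorProduct.induction_on with
  | zero => simp only [map_zero, zero_mul]
  | tmul u v => simp [comulRight, leg₂₃, eval₂_tmul, eval_tmul, eval_comul_mul, mul_assoc]
  | add s s' hs hs' => simp only [map_add, add_mul, hs, hs']

/-- `G` satisfies the cocycle condition `(Δ ⊗ id)(G) G₁₂ = (id ⊗ Δ)(G) G₂₃` of the inverse of a
Drinfeld twist. -/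
def IsInverseCocycle (G : (H ⊗[ℂ] H)⟦X⟧) : Prop :=
  hmap ρ.comulLeft.toLinearMap G * hmap (leg₁₂ H).toLinearMap G =
    hmap ρ.comulRight.toLinearMap G * hmap (leg₂₃ H).toLinearMap G

/-- The realization `f ↦ f̂ = ι (G₍₁₎ ▷ f) * π G₍₂₎` of the elements of `A` in `R[[h]]`. -/
def hat (G : (H ⊗[ℂ] H)⟦X⟧) : A →ₗ[ℂ] R⟦X⟧ where
  toFun f := hmap (ρ.eval f) G
  map_add' f g := by rw [eval_add, hmap_add]
  map_smul' c f := by rw [eval_smul, hmap_smul, RingHom.id_apply]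

variable {ρ} {G : (H ⊗[ℂ] H)⟦X⟧}

theorem hat_apply (f : A) : ρ.hat G f = hmap (ρ.eval f) G := rfl

theorem constantCoeff_hat (hG : constantCoeff G = 1) (f : A) :
    constantCoeff (ρ.hat G f) = ρ.ι f := by
  rw [hat_apply, ← coeff_zero_eq_constantCoeff_apply, coeff_hmap,
    coeff_zero_eq_constantCoeff_apply, hG, Algebra.TensorProduct.one_def, eval_tmul]
  simp

theorem hat_one
    (hG : PowerSeries.map (((Algebra.TensorProduct.lid ℂ H).toAlgHom.comp
      (Algebra.TensorProduct.map ρ.counit (AlgHom.id ℂ H)) : H ⊗[ℂ] H →ₐ[ℂ] H) :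
        H ⊗[ℂ] H →+* H) G = 1) :
    ρ.hat G 1 = 1 := by
  have coeff_counit (k : ℕ) : Algebra.TensorProduct.lid ℂ H
      (Algebra.TensorProduct.map ρ.counit (AlgHom.id ℂ H) (coeff k G)) = coeff k 1 :=
    (coeff_map _ _ _).symm.trans (congrArg (coeff k) hG)
  ext k
  rw [hat_apply, coeff_hmap, eval_one_eq_counit, coeff_counit, coeff_one, coeff_one, apply_ite ρ.π,
    map_one, map_zero]

theorem hmap_eval_C_comul_mul (f : A) (u : H) :
    hmap (ρ.eval f) (C (ρ.comul u) * G) = C (ρ.π u) * ρ.hat G f := by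
  ext k
  simp only [hat_apply, coeff_hmap, coeff_C_mul, eval_comul_mul]

theorem hat_mul_hat_eq_hmap_eval₂ (f g : A) :
    ρ.hat G f * ρ.hat G g =
      hmap (ρ.eval₂ f g) (hmap ρ.comulRight.toLinearMap G * hmap (leg₂₃ H).toLinearMap G) := by
  rw [hat_apply, hat_apply]
  exact hmap_mul_hmap (fun s t => (ρ.eval₂_comulRight_mul_leg₂₃ f g s t).symm) G G

theorem hextend_hat_hmap_actMul_eq_hmap_eval₂ (f g : A) :
    hextend (ρ.hat G) (hmap (ρ.actMul f g) G) =
      hmap (ρ.eval₂ f g) (hmap ρ.comulLeft.toLinearMap G * hmap (leg₁₂ H).toLinearMap G) := by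
  rw [hextend_hmap]
  refine hextend_hmap_mul (fun t => ?_) G
  ext k
  simp only [LinearMap.comp_apply, hat_apply, coeff_hmap, coeff_mul_C, AlgHom.toLinearMap_apply,
    eval₂_comulLeft_mul_leg₁₂]

theorem IsInverseCocycle.hextend_hat_hmap_actMul (hG : ρ.IsInverseCocycle G) (f g : A) :
    hextend (ρ.hat G) (hmap (ρ.actMul f g) G) = ρ.hat G f * ρ.hat G g := by
  rw [hextend_hat_hmap_actMul_eq_hmap_eval₂, hat_mul_hat_eq_hmap_eval₂]
  exact congrArg _ hG

variable (ρ G) in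
/-- The representation `f ⊗ u ↦ f̂ u` of the deformed smash product in `R[[h]]`. -/
def hatRealize : A ⊗[ℂ] H →ₗ[ℂ] R⟦X⟧ :=
  LinearMap.mul' ℂ R⟦X⟧ ∘ₗ TensorProduct.map (ρ.hat G) (hconst ∘ₗ ρ.π.toLinearMap)

theorem hatRealize_tmul (f : A) (u : H) :
    ρ.hatRealize G (f ⊗ₜ u) = ρ.hat G f * C (ρ.π u) := rfl

theorem constantCoeff_hatRealize (hG : constantCoeff G = 1) (t : A ⊗[ℂ] H) :
    constantCoeff (ρ.hatRealize G t) = ρ.realize t := by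
  induction t using TensorProduct.induction_on with
  | zero => simp only [map_zero]
  | tmul f u => rw [hatRealize_tmul, map_mul, constantCoeff_hat hG, constantCoeff_C, realize_tmul]
  | add s t hs ht => simp only [map_add, hs, ht]

theorem hatRealize_map_actOn (f : A) (t : H ⊗[ℂ] H) :
    ρ.hatRealize G (TensorProduct.map (ρ.actOn f) LinearMap.id t) =
      hmap (ρ.eval f) (G * C t) := by
  induction t using TensorProduct.induction_on with
  | zero => simp only [map_zero, mul_zero]
  | tmul u v =>
    ext k
    rw [TensorProduct.map_tmul, hatRealize_tmul, coeff_mul_C, coeff_hmap, coeff_mul_C,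
      eval_mul_tmul, hat_apply, coeff_hmap, actOn_apply, LinearMap.id_apply]
  | add s t hs ht => simp only [map_add, mul_add, hs, ht]

theorem hextend_hatRealize_hmap_actOn (f : A) (z : (H ⊗[ℂ] H)⟦X⟧) :
    hextend (ρ.hatRealize G) (hmap (TensorProduct.map (ρ.actOn f) LinearMap.id) z) =
      hmap (ρ.eval f) (G * z) := by
  rw [hextend_hmap, hextend_hmap_mul (p := LinearMap.id) (hatRealize_map_actOn f), hmap_id]

theorem hextend_hatRealize_hmap_mulRight (w : H) (z : (A ⊗[ℂ] H)⟦X⟧) :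
    hextend (ρ.hatRealize G) (hmap (TensorProduct.map LinearMap.id (LinearMap.mulRight ℂ w)) z) =
      hextend (ρ.hatRealize G) z * C (ρ.π w) := by
  rw [hextend_hmap, hextend_mul_C]
  refine congrArg (hextend · z) (TensorProduct.ext' fun f u => ?_)
  simp [hatRealize_tmul, mul_assoc]

theorem hextend_hatRealize_hmap_mk (v : H) (z : A⟦X⟧) :
    hextend (ρ.hatRealize G) (hmap ((TensorProduct.mk ℂ A H).flip v) z) =
      hextend (ρ.hat G) z * C (ρ.π v) := by
  rw [hextend_hmap, hextend_mul_C (ρ.hat G) z]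
  rfl

end CovariantRep

attribute [local instance 100] LieRing.ofAssociativeRing
attribute [local instance 100] LieAlgebra.ofAssociativeAlgebra

@[elab_as_elim]
theorem envelopingAlgebra_induction {K 𝔤 : Type*} [CommRing K] [LieRing 𝔤] [LieAlgebra K 𝔤]
    {motive : UniversalEnvelopingAlgebra K 𝔤 → Prop} (algebraMap : ∀ c, motive (algebraMap K _ c))
    (ι : ∀ a, motive (UniversalEnvelopingAlgebra.ι K a))
    (add : ∀ u v, motive u → motive v → motive (u + v))
    (mul : ∀ u v, motive u → motive v → motive (u * v))
    (u : UniversalEnvelopingAlgebra K 𝔤) : motive u := by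
  let S : Subalgebra K (UniversalEnvelopingAlgebra K 𝔤) :=
    { carrier := {u | motive u}
      mul_mem' := mul _ _
      add_mem' := add _ _
      algebraMap_mem' := algebraMap }
  let toS : 𝔤 →ₗ⁅K⁆ S :=
    { toFun a := ⟨UniversalEnvelopingAlgebra.ι K a, ι a⟩
      map_add' a b := Subtype.ext (map_add _ a b)
      map_smul' c a := Subtype.ext (map_smul _ c a)
      map_lie' {a b} := Subtype.ext (LieHom.map_lie _ a b) }
  have val_comp_lift : S.val.comp (UniversalEnvelopingAlgebra.lift K toS) = AlgHom.id K _ := by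
    apply UniversalEnvelopingAlgebra.hom_ext
    ext a
    exact congrArg Subtype.val (UniversalEnvelopingAlgebra.lift_ι_apply K toS a)
  have lift_eq : (UniversalEnvelopingAlgebra.lift K toS u : UniversalEnvelopingAlgebra K 𝔤) = u :=
    DFunLike.congr_fun val_comp_lift u
  rw [← lift_eq]
  exact (UniversalEnvelopingAlgebra.lift K toS u).2

section Heisenberg

variable {n : ℕ}

theorem coproduct_inc (a : Igl n) :
    coproduct n (inc n a) = inc n a ⊗ₜ[ℂ] 1 + 1 ⊗ₜ[ℂ] inc n a :=
  UniversalEnvelopingAlgebra.lift_ι_apply ℂ _ a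

theorem counit_inc (a : Igl n) : counit n (inc n a) = 0 :=
  UniversalEnvelopingAlgebra.lift_ι_apply ℂ _ a

theorem action_inc_one (a : Igl n) : action n (inc n a) 1 = counit n (inc n a) • 1 := by
  rw [action_inc, counit_inc, zero_smul, Derivation.map_one_eq_zero]

theorem action_one (u : U n) : action n u 1 = counit n u • (1 : Coord n) := by
  induction u using envelopingAlgebra_induction with
  | algebraMap c => simp [Algebra.algebraMap_eq_smul_one]
  | ι a => exact action_inc_one a
  | add u v hu hv => rw [map_add, LinearMap.add_apply, hu, hv, map_add, add_smul]
  | mul u v hu hv =>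
    rw [map_mul, Module.End.mul_apply, hv, map_smul, hu, smul_smul, map_mul, mul_comm]

theorem action_inc_mul_map (f g : Coord n) (a : Igl n) (t : U n ⊗[ℂ] U n) :
    action n (inc n a) (LinearMap.mul' ℂ _ (TensorProduct.map (actOn f) (actOn g) t)) =
      LinearMap.mul' ℂ _
        (TensorProduct.map (actOn f) (actOn g) (coproduct n (inc n a) * t)) := by
  induction t using TensorProduct.induction_on with
  | zero => simp only [map_zero, mul_zero]
  | tmul u v =>
    simp [coproduct_inc, add_mul, actOn, action_inc, mul_comm, add_comm]
  | add s t hs ht => simp only [map_add, mul_add, hs, ht]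

theorem action_mul_map (f g : Coord n) (u : U n) (t : U n ⊗[ℂ] U n) :
    action n u (LinearMap.mul' ℂ _ (TensorProduct.map (actOn f) (actOn g) t)) =
      LinearMap.mul' ℂ _ (TensorProduct.map (actOn f) (actOn g) (coproduct n u * t)) := by
  induction u using envelopingAlgebra_induction generalizing t with
  | algebraMap c => simp [Algebra.algebraMap_eq_smul_one]
  | ι a => exact action_inc_mul_map f g a t
  | add u v hu hv => simp only [map_add, LinearMap.add_apply, add_mul, hu, hv]
  | mul u v hu hv => rw [map_mul, Module.End.mul_apply, hv, hu, map_mul (coproduct n), mul_assoc]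

namespace Weyl

theorem heisenberg_inc (a : Igl n) : heisenberg n (inc n a) =
    ∑ μ, ∑ ν, (Complex.I * a.gl μ ν) • (x μ * P ν) + ∑ ν, a.tr ν • P ν :=
  UniversalEnvelopingAlgebra.lift_ι_apply ℂ _ a

theorem P_mul_x_eq_smul (μ ν : Fin n) :
    P μ * x ν = x ν * P μ + (if μ = ν then -Complex.I else 0) • (1 : Weyl n) := by
  rw [P_mul_x, Algebra.algebraMap_eq_smul_one]

theorem xP_mul_x (μ ν ρ : Fin n) : x μ * P ν * x ρ =
    x ρ * (x μ * P ν) + (if ν = ρ then -Complex.I else 0) • (x μ : Weyl n) := by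
  rw [mul_assoc, P_mul_x_eq_smul, mul_add, ← mul_assoc, ← mul_assoc, x_mul_x μ ρ, mul_smul_comm,
    mul_one]

theorem heisenberg_inc_mul_x (a : Igl n) (ρ : Fin n) :
    heisenberg n (inc n a) * x ρ =
      x ρ * heisenberg n (inc n a) + ofCoord n (vectorField a (MvPolynomial.X ρ)) := by
  have mul_I_mul_I (z : ℂ) : z * Complex.I * Complex.I = -z := by
    linear_combination z * Complex.I_mul_I
  rw [heisenberg_inc, vectorField_X]
  simp only [add_mul, mul_add, Finset.sum_mul, Finset.mul_sum, smul_mul_assoc, mul_smul_comm,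
    xP_mul_x, P_mul_x_eq_smul, smul_add, Finset.sum_add_distrib, smul_smul, map_add, map_sum,
    map_smul, ofCoord_X]
  simp [mul_I_mul_I, MvPolynomial.C_eq_smul_one, mul_comm Complex.I]
  abel

theorem heisenberg_inc_mul_ofCoord (a : Igl n) (f : Coord n) :
    heisenberg n (inc n a) * ofCoord n f =
      ofCoord n f * heisenberg n (inc n a) + ofCoord n (vectorField a f) := by
  induction f using MvPolynomial.induction_on with
  | C c => simp [← MvPolynomial.algebraMap_eq, Algebra.commutes]
  | add f g hf hg =>
    simp only [map_add, mul_add, add_mul, hf, hg]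
    abel
  | mul_X f ρ hf =>
    calc heisenberg n (inc n a) * ofCoord n (f * MvPolynomial.X ρ)
        = (ofCoord n f * heisenberg n (inc n a) + ofCoord n (vectorField a f)) * x ρ := by
          rw [map_mul, ofCoord_X, ← mul_assoc, hf]
      _ = ofCoord n f * (x ρ * heisenberg n (inc n a) +
            ofCoord n (vectorField a (MvPolynomial.X ρ))) + ofCoord n (vectorField a f) * x ρ := by
          rw [add_mul, mul_assoc, heisenberg_inc_mul_x]
      _ = _ := by
          rw [Derivation.leibniz, smul_eq_mul, smul_eq_mul, mul_comm (MvPolynomial.X ρ), map_add,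
            map_mul, map_mul, map_mul, ofCoord_X, mul_add, mul_assoc, add_assoc]

theorem heisenberg_inc_mul_realize (f : Coord n) (a : Igl n) (t : U n ⊗[ℂ] U n) :
    heisenberg n (inc n a) * realize n (actLeft f t) =
      realize n (actLeft f (coproduct n (inc n a) * t)) := by
  induction t using TensorProduct.induction_on with
  | zero => simp only [map_zero, mul_zero]
  | tmul u v =>
    simp [coproduct_inc, add_mul, realize, actLeft, actOn, action_inc, ← mul_assoc,
      heisenberg_inc_mul_ofCoord, add_comm]
  | add s t hs ht => simp only [map_add, mul_add, hs, ht]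

theorem heisenberg_mul_realize (f : Coord n) (u : U n) (t : U n ⊗[ℂ] U n) :
    heisenberg n u * realize n (actLeft f t) = realize n (actLeft f (coproduct n u * t)) := by
  induction u using envelopingAlgebra_induction generalizing t with
  | algebraMap c => simp [Algebra.algebraMap_eq_smul_one]
  | ι a => exact heisenberg_inc_mul_realize f a t
  | add u v hu hv => simp only [map_add, add_mul, hu, hv]
  | mul u v hu hv => rw [map_mul, mul_assoc, hv, hu, map_mul (coproduct n), mul_assoc]

theorem realize_comp_actLeft (f : Coord n) : realize n ∘ₗ actLeft f =
    LinearMap.mul' ℂ (Weyl n) ∘ₗ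
      TensorProduct.map ((ofCoord n).toLinearMap ∘ₗ actOn f) (heisenberg n).toLinearMap := by
  rw [realize, actLeft, LinearMap.comp_assoc, ← TensorProduct.map_comp, LinearMap.comp_id]

end Weyl

/-- The Heisenberg realization as a covariant representation of `U(𝔦𝔤𝔩(n))` and `𝔛ⁿ` in `𝔚ⁿ`. -/
def heisenbergRep (n : ℕ) : CovariantRep (U n) (Coord n) (Weyl n) where
  comul := coproduct n
  counit := counit n
  act := action n
  ι := Weyl.ofCoord n
  π := Weyl.heisenberg n
  act_one := action_one
  act_mul u f g := by
    have expand := action_mul_map f g u 1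
    rw [mul_one, Algebra.TensorProduct.one_def, TensorProduct.map_tmul, LinearMap.mul'_apply]
      at expand
    simpa [actOn] using expand
  π_mul_ι u f :=
    calc Weyl.heisenberg n u * Weyl.ofCoord n f
        = Weyl.heisenberg n u * Weyl.realize n (actLeft f 1) := by
          simp [Algebra.TensorProduct.one_def, Weyl.realize, actLeft, actOn]
      _ = Weyl.realize n (actLeft f (coproduct n u)) := by
          rw [Weyl.heisenberg_mul_realize, mul_one]
      _ = _ := LinearMap.congr_fun (Weyl.realize_comp_actLeft f) (coproduct n u)

end Heisenberg

section Twist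

open CovariantRep

variable {n : ℕ} {F : ((U n ⊗[ℂ] U n)⟦X⟧)ˣ}

theorem map_val_inv_eq_one {M N : Type*} [Monoid M] [Monoid N] (φ : M →* N) {u : Mˣ}
    (hu : φ u = 1) : φ ↑u⁻¹ = 1 := by
  simpa only [map_mul, hu, one_mul, map_one] using congrArg φ u.mul_inv

theorem IsTwist.isInverseCocycle (hF : IsTwist F) :
    (heisenbergRep n).IsInverseCocycle ↑F⁻¹ := by
  let mapUnits (φ : U n ⊗[ℂ] U n →ₐ[ℂ] U n ⊗[ℂ] (U n ⊗[ℂ] U n)) :=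
    Units.map (PowerSeries.map (φ : U n ⊗[ℂ] U n →+* U n ⊗[ℂ] (U n ⊗[ℂ] U n))).toMonoidHom
  have cocycle : mapUnits (leg₁₂ (U n)) F * mapUnits (heisenbergRep n).comulLeft F =
      mapUnits (leg₂₃ (U n)) F * mapUnits (heisenbergRep n).comulRight F :=
    Units.ext hF.cocycle
  have inv_cocycle := congrArg Units.val (congrArg Inv.inv cocycle)
  simp only [mul_inv_rev, ← map_inv, Units.val_mul] at inv_cocycle
  simp only [IsInverseCocycle, hmap_algHom]
  exact inv_cocycle

theorem IsTwist.constantCoeff_hat (hF : IsTwist F) (f : Coord n) :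
    PowerSeries.constantCoeff ((heisenbergRep n).hat ↑F⁻¹ f) = Weyl.ofCoord n f :=
  CovariantRep.constantCoeff_hat
    (map_val_inv_eq_one PowerSeries.constantCoeff.toMonoidHom hF.constantCoeff) f

theorem IsTwist.constantCoeff_hatRealize (hF : IsTwist F) (t : Coord n ⊗[ℂ] U n) :
    PowerSeries.constantCoeff ((heisenbergRep n).hatRealize ↑F⁻¹ t) = Weyl.realize n t :=
  CovariantRep.constantCoeff_hatRealize
    (map_val_inv_eq_one PowerSeries.constantCoeff.toMonoidHom hF.constantCoeff) t

theorem IsTwist.hat_one (hF : IsTwist F) : (heisenbergRep n).hat ↑F⁻¹ 1 = 1 :=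
  CovariantRep.hat_one (map_val_inv_eq_one (PowerSeries.map _).toMonoidHom hF.counit_left)

theorem realizedHat_eq_hat (F : ((U n ⊗[ℂ] U n)⟦X⟧)ˣ) (f : Coord n) :
    realizedHat F f = (heisenbergRep n).hat ↑F⁻¹ f :=
  hmap_hmap _ _ _

theorem IsTwist.hextend_hat_starProduct (hF : IsTwist F) (f g : Coord n) :
    hextend ((heisenbergRep n).hat ↑F⁻¹) (starProduct F f g) =
      (heisenbergRep n).hat ↑F⁻¹ f * (heisenbergRep n).hat ↑F⁻¹ g :=
  hF.isInverseCocycle.hextend_hat_hmap_actMul f g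

theorem IsTwist.hextend_hatRealize_starLeft (hF : IsTwist F) (f : Coord n)
    (z : (Coord n ⊗[ℂ] U n)⟦X⟧) :
    hextend ((heisenbergRep n).hatRealize ↑F⁻¹) (hextend (starLeft F f) z) =
      (heisenbergRep n).hat ↑F⁻¹ f * hextend ((heisenbergRep n).hatRealize ↑F⁻¹) z := by
  let Ψ := (heisenbergRep n).hatRealize (↑F⁻¹ : (U n ⊗[ℂ] U n)⟦X⟧)
  have on_pure_tensors : hextendLin Ψ ∘ₗ hextendLin (starLeft F f) =
      LinearMap.mulLeft ℂ⟦X⟧ ((heisenbergRep n).hat ↑F⁻¹ f) ∘ₗ hextendLin Ψ := by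
    refine hadic_ext_tmul fun g v => ?_
    rw [LinearMap.comp_apply, LinearMap.comp_apply, hextendLin_C, hextendLin_C,
      LinearMap.mulLeft_apply, hatRealize_tmul, ← mul_assoc, ← hF.hextend_hat_starProduct]
    exact hextend_hatRealize_hmap_mk v (starProduct F f g)
  exact LinearMap.congr_fun on_pure_tensors z

theorem hextend_hatRealize_actLeft_twistedCoproduct (g : Coord n) (u : U n) :
    hextend ((heisenbergRep n).hatRealize ↑F⁻¹) (hmap (actLeft g) (twistedCoproduct F u)) =
      C (Weyl.heisenberg n u) * (heisenbergRep n).hat ↑F⁻¹ g :=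
  calc hextend ((heisenbergRep n).hatRealize ↑F⁻¹) (hmap (actLeft g) (twistedCoproduct F u))
      = hmap ((heisenbergRep n).eval g) (↑F⁻¹ * (↑F * (C (coproduct n u) * ↑F⁻¹))) :=
        hextend_hatRealize_hmap_actOn g _
    _ = hmap ((heisenbergRep n).eval g) (C (coproduct n u) * ↑F⁻¹) := by
        rw [Units.inv_mul_cancel_left]
    _ = _ := hmap_eval_C_comul_mul g u

theorem IsTwist.hextend_hatRealize_smashPure (hF : IsTwist F) (f g : Coord n) (u w : U n) :
    hextend ((heisenbergRep n).hatRealize ↑F⁻¹) (smashPure F f u g w) =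
      (heisenbergRep n).hatRealize ↑F⁻¹ (f ⊗ₜ u) * (heisenbergRep n).hatRealize ↑F⁻¹ (g ⊗ₜ w) := by
  rw [smashPure, mulMom, hextend_hatRealize_hmap_mulRight, hF.hextend_hatRealize_starLeft,
    hextend_hatRealize_actLeft_twistedCoproduct, hatRealize_tmul, hatRealize_tmul]
  simp only [mul_assoc]
  rfl

theorem IsTwist.hextend_hatRealize_smash (hF : IsTwist F) (a b : (Coord n ⊗[ℂ] U n)⟦X⟧) :
    hextend ((heisenbergRep n).hatRealize ↑F⁻¹) (smash F a b) =
      hextend ((heisenbergRep n).hatRealize ↑F⁻¹) a *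
        hextend ((heisenbergRep n).hatRealize ↑F⁻¹) b := by
  refine map_hextend₂_eq_mul (Φ := hextendLin ((heisenbergRep n).hatRealize ↑F⁻¹))
    (fun s t => ?_) a b
  simp only [hextendLin_C]
  induction s using TensorProduct.induction_on with
  | zero => simp only [map_zero, LinearMap.zero_apply, zero_mul]
  | add s s' hs hs' => simp only [map_add, LinearMap.add_apply, add_mul, hs, hs']
  | tmul f u =>
    induction t using TensorProduct.induction_on with
    | zero => simp only [map_zero, mul_zero]
    | add t t' ht ht' => simp only [map_add, mul_add, ht, ht']
    | tmul g w => exact hF.hextend_hatRealize_smashPure f g u w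

end Twist

section NormalOrdering

variable {n : ℕ}

theorem vectorField_P_X (μ ν : Fin n) :
    vectorField (Igl.P μ) (MvPolynomial.X ν) =
      MvPolynomial.C (if μ = ν then -Complex.I else 0) := by
  rw [← action_inc, action_P_X]

theorem commute_inc_P (μ ν : Fin n) : Commute (inc n (Igl.P μ)) (inc n (Igl.P ν)) := by
  rw [commute_iff_lie_eq, ← LieHom.map_lie, Igl.lie_P_P, map_zero]

theorem vectorField_P_comm (μ ν : Fin n) (f : Coord n) :
    vectorField (Igl.P μ) (vectorField (Igl.P ν) f) =
      vectorField (Igl.P ν) (vectorField (Igl.P μ) f) := by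
  simpa [action_inc] using
    LinearMap.congr_fun ((commute_inc_P μ ν).map (action n)).eq f

/-- The generator `P_μ` of `𝔗ⁿ`. -/
def momentum (μ : Fin n) : momenta n := ⟨inc n (Igl.P μ), Algebra.subset_adjoin ⟨μ, rfl⟩⟩

theorem momentum_mul_momentum_mul (μ ν : Fin n) (p : momenta n) :
    momentum μ * (momentum ν * p) = momentum ν * (momentum μ * p) :=
  Subtype.ext ((commute_inc_P μ ν).left_comm p)

namespace Weyl

theorem adjoin_x_P (n : ℕ) :
    Algebra.adjoin ℂ (Set.range (x : Fin n → Weyl n) ∪ Set.range P) = ⊤ := by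
  refine eq_top_iff.2 fun w _ => ?_
  obtain ⟨a, rfl⟩ := RingQuot.mkAlgHom_surjective ℂ (WeylRel n) w
  have map_ι_mem : ∀ g, quot n (FreeAlgebra.ι ℂ g) ∈ Algebra.adjoin ℂ (Set.range x ∪ Set.range P)
    | .x μ => Algebra.subset_adjoin (Or.inl ⟨μ, rfl⟩)
    | .P μ => Algebra.subset_adjoin (Or.inr ⟨μ, rfl⟩)
  change quot n a ∈ _
  induction a using FreeAlgebra.induction with
  | grade0 c =>
    rw [AlgHom.commutes]
    exact Subalgebra.algebraMap_mem _ c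
  | grade1 g => exact map_ι_mem g
  | mul a b ha hb =>
    rw [map_mul]
    exact mul_mem (ha trivial) (hb trivial)
  | add a b ha hb =>
    rw [map_add]
    exact add_mem (ha trivial) (hb trivial)

/-- Normal ordering `f ⊗ p ↦ f p`, with the coordinates to the left of the momenta. -/
def normalOrder (n : ℕ) : Coord n ⊗[ℂ] momenta n →ₗ[ℂ] Weyl n :=
  realize n ∘ₗ TensorProduct.map LinearMap.id (momenta n).val.toLinearMap

theorem normalOrder_tmul (f : Coord n) (p : momenta n) :
    normalOrder n (f ⊗ₜ p) = ofCoord n f * heisenberg n p := rfl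

/-- The operator on symbols `t ∈ 𝔛ⁿ ⊗ 𝔗ⁿ` that corresponds to left multiplication by `x^μ` of
the normally ordered elements. -/
def symbolX (μ : Fin n) : Module.End ℂ (Coord n ⊗[ℂ] momenta n) :=
  TensorProduct.map (LinearMap.mulLeft ℂ (MvPolynomial.X μ)) LinearMap.id

/-- The operator on symbols `t ∈ 𝔛ⁿ ⊗ 𝔗ⁿ` that corresponds to left multiplication by `P_μ` of
the normally ordered elements. -/
def symbolP (μ : Fin n) : Module.End ℂ (Coord n ⊗[ℂ] momenta n) :=
  TensorProduct.map LinearMap.id (LinearMap.mulLeft ℂ (momentum μ)) +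
    TensorProduct.map (vectorField (Igl.P μ) : Coord n →ₗ[ℂ] Coord n) LinearMap.id

theorem symbolX_tmul (μ : Fin n) (f : Coord n) (p : momenta n) :
    symbolX μ (f ⊗ₜ p) = (MvPolynomial.X μ * f) ⊗ₜ p := rfl

theorem symbolP_tmul (μ : Fin n) (f : Coord n) (p : momenta n) :
    symbolP μ (f ⊗ₜ p) = f ⊗ₜ (momentum μ * p) + vectorField (Igl.P μ) f ⊗ₜ p := rfl

/-- The representation of `𝔚ⁿ` on symbols that corresponds to its left regular representation
under normal ordering. -/
def symbolRep (n : ℕ) : Weyl n →ₐ[ℂ] Module.End ℂ (Coord n ⊗[ℂ] momenta n) :=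
  RingQuot.liftAlgHom ℂ ⟨FreeAlgebra.lift ℂ fun
    | .x μ => symbolX μ
    | .P μ => symbolP μ, by
      intro a b relation
      apply TensorProduct.ext'
      intro f p
      cases relation with
      | xx μ ν =>
        simp only [map_mul, FreeAlgebra.lift_ι_apply, Module.End.mul_apply, symbolX_tmul,
          mul_left_comm]
      | PP μ ν =>
        simp only [map_mul, FreeAlgebra.lift_ι_apply, Module.End.mul_apply, symbolP_tmul,
          map_add, momentum_mul_momentum_mul μ, vectorField_P_comm μ ν]
        abel
      | Px μ ν =>
        simp only [map_mul, map_add, AlgHom.commutes, FreeAlgebra.lift_ι_apply,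
          Module.End.mul_apply, LinearMap.add_apply, symbolP_tmul, symbolX_tmul,
          Module.algebraMap_end_apply, Derivation.leibniz, vectorField_P_X, smul_eq_mul,
          TensorProduct.add_tmul]
        rw [mul_comm f, ← MvPolynomial.smul_eq_C_mul, TensorProduct.smul_tmul']
        abel⟩

theorem symbolRep_x (μ : Fin n) : symbolRep n (x μ) = symbolX μ :=
  (RingQuot.liftAlgHom_mkAlgHom_apply _ _ _ _).trans (FreeAlgebra.lift_ι_apply _ _)

theorem symbolRep_P (μ : Fin n) : symbolRep n (P μ) = symbolP μ :=
  (RingQuot.liftAlgHom_mkAlgHom_apply _ _ _ _).trans (FreeAlgebra.lift_ι_apply _ _)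

theorem normalOrder_symbolX (μ : Fin n) (t : Coord n ⊗[ℂ] momenta n) :
    normalOrder n (symbolX μ t) = x μ * normalOrder n t := by
  induction t using TensorProduct.induction_on with
  | zero => simp only [map_zero, mul_zero]
  | tmul f p =>
    rw [symbolX_tmul, normalOrder_tmul, normalOrder_tmul, map_mul, ofCoord_X, mul_assoc]
  | add s t hs ht => simp only [map_add, mul_add, hs, ht]

theorem normalOrder_symbolP (μ : Fin n) (t : Coord n ⊗[ℂ] momenta n) :
    normalOrder n (symbolP μ t) = P μ * normalOrder n t := by
  have heisenberg_momentum : heisenberg n (momentum μ) = P μ := heisenberg_P μ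
  have P_mul_ofCoord (f : Coord n) :
      P μ * ofCoord n f = ofCoord n f * P μ + ofCoord n (vectorField (Igl.P μ) f) := by
    rw [← heisenberg_P, heisenberg_inc_mul_ofCoord]
  induction t using TensorProduct.induction_on with
  | zero => simp only [map_zero, mul_zero]
  | tmul f p =>
    rw [symbolP_tmul, map_add, normalOrder_tmul, normalOrder_tmul, normalOrder_tmul, ← mul_assoc,
      P_mul_ofCoord, MulMemClass.coe_mul, map_mul, heisenberg_momentum, add_mul, mul_assoc]
  | add s t hs ht => simp only [map_add, mul_add, hs, ht]

theorem normalOrder_symbolRep (w : Weyl n) (t : Coord n ⊗[ℂ] momenta n) :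
    normalOrder n (symbolRep n w t) = w * normalOrder n t := by
  have hw : w ∈ Algebra.adjoin ℂ (Set.range x ∪ Set.range P) := adjoin_x_P n ▸ Algebra.mem_top
  induction hw using Algebra.adjoin_induction generalizing t with
  | mem w hw =>
    rcases hw with ⟨μ, rfl⟩ | ⟨μ, rfl⟩
    · rw [symbolRep_x, normalOrder_symbolX]
    · rw [symbolRep_P, normalOrder_symbolP]
  | algebraMap c =>
    rw [AlgHom.commutes, Module.algebraMap_end_apply, map_smul, Algebra.smul_def]
  | add v w _ _ hv hw => rw [map_add, LinearMap.add_apply, map_add, hv, hw, add_mul]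
  | mul v w _ _ hv hw => rw [map_mul, Module.End.mul_apply, hv, hw, mul_assoc]

theorem symbolRep_ofCoord (f g : Coord n) (p : momenta n) :
    symbolRep n (ofCoord n f) (g ⊗ₜ p) = (f * g) ⊗ₜ p := by
  induction f using MvPolynomial.induction_on generalizing g with
  | C c =>
    rw [← MvPolynomial.algebraMap_eq, AlgHom.commutes, AlgHom.commutes,
      Module.algebraMap_end_apply, ← Algebra.smul_def, TensorProduct.smul_tmul']
  | add f f' hf hf' =>
    rw [map_add, map_add, LinearMap.add_apply, hf, hf', add_mul, TensorProduct.add_tmul]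
  | mul_X f μ hf =>
    rw [map_mul, map_mul, Module.End.mul_apply, ofCoord_X, symbolRep_x, symbolX_tmul, hf,
      mul_assoc]

theorem symbolRep_heisenberg (p q : momenta n) :
    symbolRep n (heisenberg n p) (1 ⊗ₜ q) = 1 ⊗ₜ (p * q) := by
  obtain ⟨p, hp⟩ := p
  induction hp using Algebra.adjoin_induction generalizing q with
  | mem p hp =>
    obtain ⟨μ, rfl⟩ := hp
    rw [heisenberg_P, symbolRep_P, symbolP_tmul, Derivation.map_one_eq_zero,
      TensorProduct.zero_tmul, add_zero]
    rfl
  | algebraMap c =>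
    rw [AlgHom.commutes, AlgHom.commutes, Module.algebraMap_end_apply, ← TensorProduct.tmul_smul,
      Algebra.smul_def]
    rfl
  | add p p' _ _ hp hp' =>
    rw [map_add, map_add, LinearMap.add_apply, hp, hp', ← TensorProduct.tmul_add, ← add_mul]
    rfl
  | mul p p' _ _ hp hp' =>
    rw [map_mul, map_mul, Module.End.mul_apply, hp', hp, ← mul_assoc]
    rfl

theorem symbolRep_normalOrder (t : Coord n ⊗[ℂ] momenta n) :
    symbolRep n (normalOrder n t) (1 ⊗ₜ 1) = t := by
  induction t using TensorProduct.induction_on with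
  | zero => simp only [map_zero, LinearMap.zero_apply]
  | tmul f p =>
    rw [normalOrder_tmul, map_mul, Module.End.mul_apply, symbolRep_heisenberg, symbolRep_ofCoord,
      mul_one, mul_one]
  | add s t hs ht => rw [map_add, map_add, LinearMap.add_apply, hs, ht]

theorem normalOrder_bijective (n : ℕ) : Function.Bijective (normalOrder n) := by
  refine ⟨Function.LeftInverse.injective (g := fun w => symbolRep n w (1 ⊗ₜ 1))
    symbolRep_normalOrder, fun w => ⟨symbolRep n w (1 ⊗ₜ 1), ?_⟩⟩
  rw [normalOrder_symbolRep, normalOrder_tmul, map_one, one_mul, OneMemClass.coe_one, map_one,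
    mul_one]

end Weyl

end NormalOrdering

section SmashClosure

theorem range_tensorProduct_map_le_iff {R M M' N N' : Type*} [CommSemiring R]
    [AddCommMonoid M] [Module R M] [AddCommMonoid M'] [Module R M']
    [AddCommMonoid N] [Module R N] [AddCommMonoid N'] [Module R N']
    {φ : M →ₗ[R] M'} {ψ : N →ₗ[R] N'} {V : Submodule R (M' ⊗[R] N')} :
    LinearMap.range (TensorProduct.map φ ψ) ≤ V ↔ ∀ m n, φ m ⊗ₜ ψ n ∈ V := by
  rw [TensorProduct.range_map_eq_span_tmul, Submodule.span_le]
  exact ⟨fun h m n => h ⟨m, n, rfl⟩, fun h _ ⟨m, n, hmn⟩ => hmn ▸ h m n⟩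

/-- The subspace `𝔛ⁿ ⊗ 𝔗ⁿ` of `𝔛ⁿ ⊗ U(𝔦𝔤𝔩(n))`, in which the coefficients of the elements of the
deformed Weyl algebra lie. -/
def coordMomenta (n : ℕ) : Submodule ℂ (Coord n ⊗[ℂ] U n) :=
  LinearMap.range (TensorProduct.map LinearMap.id (momenta n).val.toLinearMap)

variable {n : ℕ} {F : ((U n ⊗[ℂ] U n)⟦X⟧)ˣ}

theorem tmul_mem_coordMomenta (f : Coord n) {p : U n} (hp : p ∈ momenta n) :
    f ⊗ₜ p ∈ coordMomenta n :=
  ⟨f ⊗ₜ ⟨p, hp⟩, rfl⟩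

theorem momenta_tmul_momenta_le_comap_actLeft (g : Coord n) :
    LinearMap.range
        (TensorProduct.map (momenta n).val.toLinearMap (momenta n).val.toLinearMap) ≤
      (coordMomenta n).comap (actLeft g) :=
  range_tensorProduct_map_le_iff.2 fun p q => tmul_mem_coordMomenta (actOn g p) q.2

theorem coordMomenta_le_comap_starLeft (F : ((U n ⊗[ℂ] U n)⟦X⟧)ˣ) (f : Coord n) :
    coordMomenta n ≤ (hadicSubmodule (coordMomenta n)).comap (starLeft F f) :=
  range_tensorProduct_map_le_iff.2 fun g p => hmap_mem_hadicSubmodule (S := ⊤) (T := coordMomenta n)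
    (φ := (TensorProduct.mk ℂ (Coord n) (U n)).flip p)
    (fun k _ => tmul_mem_coordMomenta k p.2) (a := starProduct F f g) fun _ => Submodule.mem_top

theorem coordMomenta_le_comap_mulMom {q : U n} (hq : q ∈ momenta n) :
    coordMomenta n ≤ (coordMomenta n).comap (mulMom q) :=
  range_tensorProduct_map_le_iff.2 fun f p => tmul_mem_coordMomenta f (mul_mem p.2 hq)

theorem smashPure_mem (hF : MomentaHopf F) (f g : Coord n) {p q : U n} (hp : p ∈ momenta n)
    (hq : q ∈ momenta n) : smashPure F f p g q ∈ hadicSubmodule (coordMomenta n) :=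
  hmap_mem_hadicSubmodule (coordMomenta_le_comap_mulMom hq) <|
    hextend_mem_hadicSubmodule (coordMomenta_le_comap_starLeft F f) <|
      hmap_mem_hadicSubmodule (momenta_tmul_momenta_le_comap_actLeft g) (hF p hp)

theorem smash_mem_deformedWeyl (hF : MomentaHopf F) {a b : (Coord n ⊗[ℂ] U n)⟦X⟧}
    (ha : a ∈ deformedWeyl n) (hb : b ∈ deformedWeyl n) : smash F a b ∈ deformedWeyl n := by
  refine hextend₂_mem_hadicSubmodule (S := coordMomenta n) (T := coordMomenta n)
    (V := coordMomenta n) (fun s hs t ht => ?_) ha hb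
  have le_comap_smashBilin_tmul (f : Coord n) (p : momenta n) :
      coordMomenta n ≤
        (hadicSubmodule (coordMomenta n)).comap (smashBilin F (f ⊗ₜ (p : U n))) :=
    range_tensorProduct_map_le_iff.2 fun g q => smashPure_mem hF f g p.2 q.2
  have le_comap_smashBilin_flip :
      coordMomenta n ≤ (hadicSubmodule (coordMomenta n)).comap ((smashBilin F).flip t) :=
    range_tensorProduct_map_le_iff.2 fun f p => le_comap_smashBilin_tmul f p ht
  exact le_comap_smashBilin_flip hs

end SmashClosure

section Isomorphism

variable {n : ℕ} {F : ((U n ⊗[ℂ] U n)⟦X⟧)ˣ}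

theorem Weyl.bijOn_realize (n : ℕ) :
    Set.BijOn (Weyl.realize n) (coordMomenta n) Set.univ := by
  obtain ⟨hinj, hsurj⟩ := Weyl.normalOrder_bijective n
  refine ⟨Set.mapsTo_univ _ _, ?_, fun w _ => ?_⟩
  · rintro _ ⟨s, rfl⟩ _ ⟨t, rfl⟩ h
    rw [hinj h]
  · obtain ⟨t, ht⟩ := hsurj w
    exact ⟨_, ⟨t, rfl⟩, ht⟩

theorem IsTwist.hextend_hatRealize_bijOn (hF : IsTwist F) :
    Set.BijOn (hextend ((heisenbergRep n).hatRealize ↑F⁻¹)) (deformedWeyl n) Set.univ :=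
  hextend_bijOn <| (Weyl.bijOn_realize n).congr fun t _ => (hF.constantCoeff_hatRealize t).symm

/-- The isomorphism `f ⊗ p ↦ f̂ p` from the deformed Weyl algebra onto `𝔚ⁿ[[h]]`. -/
def IsTwist.weylEquiv (hF : IsTwist F) : deformedWeyl n ≃ₗ[ℂ⟦X⟧] (Weyl n)⟦X⟧ :=
  LinearEquiv.ofBijective
    (hextendLin ((heisenbergRep n).hatRealize ↑F⁻¹) ∘ₗ (deformedWeyl n).subtype)
    ⟨hF.hextend_hatRealize_bijOn.injOn.injective,
      Set.surjOn_iff_surjective.1 hF.hextend_hatRealize_bijOn.surjOn⟩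

theorem IsTwist.weylEquiv_tensor (hF : IsTwist F) (f : Coord n) (p : momenta n) :
    hF.weylEquiv (tensor f p) = (heisenbergRep n).hat ↑F⁻¹ f * C (Weyl.heisenberg n p) :=
  hextend_C _ _

theorem IsTwist.constantCoeff_realizedHat_X (hF : IsTwist F) (μ : Fin n) :
    PowerSeries.constantCoeff (realizedHat F (MvPolynomial.X μ)) = Weyl.x μ := by
  rw [realizedHat_eq_hat, hF.constantCoeff_hat, Weyl.ofCoord_X]

theorem IsTwist.adjoin_constantCoeff_image (hF : IsTwist F) :
    Algebra.adjoin ℂ (PowerSeries.constantCoeff ''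
      (Set.range (fun μ => realizedHat F (MvPolynomial.X μ)) ∪
        Set.range fun μ => (C (Weyl.P μ) : (Weyl n)⟦X⟧))) = ⊤ := by
  rw [Set.image_union, ← Set.range_comp, ← Set.range_comp, ← Weyl.adjoin_x_P]
  simp only [Function.comp_def, hF.constantCoeff_realizedHat_X, constantCoeff_C]

end Isomorphism

end TwistedWeyl

end

open TwistedWeyl in
theorem proposition3 (n : ℕ) (F : ((U n ⊗[ℂ] U n)⟦X⟧)ˣ) (hF : IsTwist F) :
    (MomentaHopf F → ∀ a b : deformedWeyl n, smash F a b ∈ deformedWeyl n) ∧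
    (∃ e : deformedWeyl n ≃ₗ[ℂ⟦X⟧] (Weyl n)⟦X⟧,
      e (tensor 1 1) = 1 ∧
      (∀ (a b : deformedWeyl n) (hab : smash F a b ∈ deformedWeyl n),
        e ⟨smash F a b, hab⟩ = e a * e b) ∧
      (∀ f : Coord n, e (tensor f 1) = realizedHat F f) ∧
      (∀ p : momenta n, e (tensor 1 p) = PowerSeries.C (Weyl.heisenberg n p))) ∧
    (∀ (w : (Weyl n)⟦X⟧) (k : ℕ),
      ∃ a ∈ Algebra.adjoin ℂ⟦X⟧
          (Set.range (fun μ : Fin n => realizedHat F (MvPolynomial.X μ)) ∪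
            Set.range (fun μ : Fin n => (PowerSeries.C (Weyl.P μ) : (Weyl n)⟦X⟧))),
        ∀ j < k, PowerSeries.coeff j w = PowerSeries.coeff j a) := by
  refine ⟨fun hP a b => smash_mem_deformedWeyl hP a.2 b.2,
    ⟨hF.weylEquiv, ?_, fun a b _ => hF.hextend_hatRealize_smash a b, fun f => ?_, fun p => ?_⟩,
    exists_mem_adjoin_forall_lt_coeff_eq hF.adjoin_constantCoeff_image⟩
  · rw [hF.weylEquiv_tensor, hF.hat_one, OneMemClass.coe_one, map_one, map_one, mul_one]
  · rw [hF.weylEquiv_tensor, OneMemClass.coe_one, map_one, map_one, mul_one, realizedHat_eq_hat]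
  · rw [hF.weylEquiv_tensor, hF.hat_one, one_mul]
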